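/- **Setting.** Write $g^c=c^{-1}gc$ and $[a,b]=aba^{-1}b^{-1}$. For $n,p\ge 0$ let $\mathbb F^{n+2p}$ be the free group on $\gamma_1,\dots,\gamma_n,\lambda_1,\dots,\lambda_p,\mu_1,\dots,\mu_p$. For $0\le k\le p$ and $n\ge1$ put $\gamma_{n}^{(k)}=\gamma_n^{[\lambda_1,\mu_1]\cdots[\lambda_k,\mu_k]}$. Let $Br_{n,p}\subset \mathrm{Aut}(\mathbb F^{n+2p})$ be the subgroup generated by the following automorphisms, where $1\le i\le n-1$ for $\sigma_i$, and $n\ge 1$, $1\le i\le p$ for the others: - $\sigma_i$: $\gamma_i\mapsto\gamma_{i+1}$, $\gamma_{i+1}\mapsto\gamma_i^{\gamma_{i+1}}$, all other generators fixed; - $\xi_{i,\lambda}$: with $\gamma=\gamma_n^{(i-1)}$, $\gamma\mapsto\gamma^{\lambda_i\mu_i^{-1}\lambda_i^{-1}\gamma^{-1}}$, $\lambda_i\mapsto\gamma\lambda_i$; - $\xi_{i,\mu}$: with $\gamma=\gamma_n^{(i)}$, $\gamma\mapsto\gamma^{\mu_i\lambda_i^{-1}\mu_i^{-1}\gamma}$,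 $\mu_i\mapsto\gamma^{-1}\mu_i$; - $\zeta_i$: with $\gamma=\gamma_n^{(i-1)}$ and $c=\gamma^{[\lambda_i,\mu_i]}$, $\gamma\mapsto c$, $\lambda_i\mapsto\lambda_i^{c}$, $\mu_i\mapsto\mu_i^{c}$; in the last three cases all other $\gamma_j$ ($j\ne n$), $\lambda_j$, $\mu_j$ are fixed. A subgroup $H_{n,p}\subset\mathrm{Aut}(\mathbb F^{n+2p})$ is *admissible* if it contains $Br_{n,p}$, if for each $h\in H_{n,p}$ there is a permutation $\sigma_h\in\mathcal S_n$ such that $h(\gamma_i)$ is conjugate to $\gamma_{\sigma_h(i)}$ for all $i$, and if each $h\in H_{n,p}$ fixes $\gamma_1\cdots\gamma_n[\lambda_1,\mu_1]\cdots[\lambda_p,\mu_p]$. An *equipment* of a group $G$ is a union $O=C_1\sqcup\dots\sqcup C_m$ of finitely many distinct conjugacy classes of $G$, listed in a fixed order, with ${\bf 1}\notin O$. Given a collection $\mathcal H=\{H_{n,p}\}_{n,p\ge0}$ of admissible groups, the *admissible covering semigroup* $\overline{\mathbb S}(G,O)=\mathbb S_{\mathcal H}(G,O)$ is the semigroup (with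 unity adjoined) generated by the letters $x_g$ ($g\in O$) and $y_{a,b}$ ($a,b\in G$) subject to the relations $x_g\cdot y_{a,b}=y_{a,b}\cdot x_{g^{[a,b]}}$ and, for all $n,p$, all $h\in H_{n,p}$ and all homomorphisms $f:\mathbb F^{n+2p}\to G$ with $f(\gamma_i)\in O$ for all $i$, $$\prod_{i=1}^n x_{f(\gamma_i)}\cdot\prod_{j=1}^p y_{f(\lambda_j),f(\mu_j)}=\prod_{i=1}^n x_{f(h(\gamma_i))}\cdot\prod_{j=1}^p y_{f(h(\lambda_j)),f(h(\mu_j))} .$$ For $s\in\overline{\mathbb S}(G,O)$ given by a word in these letters, the product $\alpha_G(s)\in G$ is defined by the homomorphism $x_g\mapsto g$, $y_{a,b}\mapsto[a,b]$; the type $\tau(s)\in\mathbb Z_{\ge0}^m$ counts, for each $i$, the letters $x_g$ with $g\in C_i$; the genus $g(s)$ is the number of letters $y_{a,b}$; and $G_s\subset G$ is the subgroup generated by all $g$ and all $a,b$ occurring in the letters $x_g$, $y_{a,b}$ of the word. All four are independent of the word. Put $\overline{\mathbb S}(G,O)^{G}=\{s\mid G_s=G\}$. **Statement.** Let $C_1$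 be the conjugacy class of an odd permutation $\sigma_1\in\mathcal S_d$ that leaves at least two elements fixed. There is a constant $T=T_{C_1}$ such that for every equipment $O=C_1\sqcup\dots\sqcup C_m$ of $\mathcal S_d$ containing $C_1$, every $\sigma\in\mathcal S_d$ and every $\overline t=(t_1,\dots,t_m)\in\mathbb Z^m_{\ge0}$ with $t_1\ge T$ the following hold. 1. For each integer $p\ge0$ and each admissible covering semigroup $\overline{\mathbb S}(\mathcal S_d,O)$, the equation $\alpha_{\mathcal S_d}(z)=\sigma$ has at most one solution $z\in\overline{\mathbb S}(\mathcal S_d,O)^{\mathcal S_d}$ with $g(z)=p$ and $\tau(z)=\overline t$. 2. For the given $\sigma$, the existence of a solution $z\in\overline{\mathbb S}(\mathcal S_d,O)^{\mathcal S_d}$ with $g(z)=p$ and $\tau(z)=\overline t$ depends only on $\overline t$: it depends neither on $p$ nor on the admissible covering semigroup. The same is true of the existence of a solution $z\in\overline{\mathbb S}(\mathcal S_d,O)$ with $g(z)=p$ and $\tau(z)=\overline t$. -/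

import Mathlib

open scoped commutatorElement

/-! ## Free groups with a frame, algebraic braid groups, admissible groups -/

/-- The free group of rank `n + 2p`, on the generators `γ_1, …, γ_n, λ_1, …, λ_p, μ_1, …, μ_p`
(indices start from `0` in the code). -/
abbrev FrameGroup (n p : ℕ) : Type := FreeGroup (Fin n ⊕ (Fin p ⊕ Fin p))

namespace FrameGroup

variable {n p : ℕ}

/-- The generator `γ_i`. -/
def gam (i : Fin n) : FrameGroup n p := FreeGroup.of (Sum.inl i)

/-- The generator `λ_j`. -/
def lam (j : Fin p) : FrameGroup n p := FreeGroup.of (Sum.inr (Sum.inl j))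

/-- The generator `μ_j`. -/
def mu (j : Fin p) : FrameGroup n p := FreeGroup.of (Sum.inr (Sum.inr j))

/-- The boundary `γ_1 ⋯ γ_n [λ_1, μ_1] ⋯ [λ_p, μ_p]`, where `[a, b] = a b a⁻¹ b⁻¹`. -/
def boundary (n p : ℕ) : FrameGroup n p :=
  (List.ofFn fun i : Fin n => (gam i : FrameGroup n p)).prod *
    (List.ofFn fun j : Fin p => ⁅(lam j : FrameGroup n p), mu j⁆).prod

/-- `[λ_1, μ_1] ⋯ [λ_k, μ_k]`. -/
def commProd (k : ℕ) : FrameGroup n p :=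
  ((List.ofFn fun j : Fin p => ⁅(lam j : FrameGroup n p), mu j⁆).take k).prod

/-- The result of moving `γ_l` to the right through the first `k` commutators: the element
`γ_l ^ ([λ_1, μ_1] ⋯ [λ_k, μ_k])`, where `g ^ c = c⁻¹ g c`. For `l = n` it is the last `γ` of the
frame in which it stands between `μ_k` and `λ_{k+1}`; the other elements of that frame are
the original generators. -/
def moved (l : Fin n) (k : ℕ) : FrameGroup n p := (commProd k)⁻¹ * gam l * commProd k

/-- `φ` is the half-twist: `γ_i ↦ γ_{i+1}`, `γ_{i+1} ↦ γ_i ^ γ_{i+1}`, all other generators fixed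
(here `i' = i + 1`). -/
structure IsSigma (i i' : Fin n) (φ : MulAut (FrameGroup n p)) : Prop where
  next : i'.val = i.val + 1
  map_i : φ (gam i) = gam i'
  map_i' : φ (gam i') = (gam i')⁻¹ * gam i * gam i'
  map_gam : ∀ j, j ≠ i → j ≠ i' → φ (gam j) = gam j
  map_lam : ∀ j, φ (lam j) = lam j
  map_mu : ∀ j, φ (mu j) = mu j

/-- `φ` is the automorphism `ξ_{i,λ}`. With `γ` the last `γ`, moved to stand just before `λ_i`:
`γ ↦ γ ^ (λ_i μ_i⁻¹ λ_i⁻¹ γ⁻¹)`, `λ_i ↦ γ λ_i`, the rest of the frame is fixed. -/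
structure IsXiLam (l : Fin n) (i : Fin p) (φ : MulAut (FrameGroup n p)) : Prop where
  last : l.val + 1 = n
  map_moved : φ (moved l i) =
    (lam i * (mu i)⁻¹ * (lam i)⁻¹ * (moved l i)⁻¹)⁻¹ * moved l i *
      (lam i * (mu i)⁻¹ * (lam i)⁻¹ * (moved l i)⁻¹)
  map_lam_self : φ (lam i) = moved l i * lam i
  map_gam : ∀ j, j ≠ l → φ (gam j) = gam j
  map_lam : ∀ j, j ≠ i → φ (lam j) = lam j
  map_mu : ∀ j, φ (mu j) = mu j

/-- `φ` is the automorphism `ξ_{i,μ}`. With `γ` the last `γ`, moved to stand just after `μ_i`: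
`γ ↦ γ ^ (μ_i λ_i⁻¹ μ_i⁻¹ γ)`, `μ_i ↦ γ⁻¹ μ_i`, the rest of the frame is fixed. -/
structure IsXiMu (l : Fin n) (i : Fin p) (φ : MulAut (FrameGroup n p)) : Prop where
  last : l.val + 1 = n
  map_moved : φ (moved l (i.val + 1)) =
    (mu i * (lam i)⁻¹ * (mu i)⁻¹ * moved l (i.val + 1))⁻¹ * moved l (i.val + 1) *
      (mu i * (lam i)⁻¹ * (mu i)⁻¹ * moved l (i.val + 1))
  map_mu_self : φ (mu i) = (moved l (i.val + 1))⁻¹ * mu i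
  map_gam : ∀ j, j ≠ l → φ (gam j) = gam j
  map_lam : ∀ j, φ (lam j) = lam j
  map_mu : ∀ j, j ≠ i → φ (mu j) = mu j

/-- The element `γ ^ [λ_i, μ_i]`, for `γ` equal to `γ_l` moved to stand just before `λ_i`. -/
def zetaConj (l : Fin n) (i : Fin p) : FrameGroup n p :=
  ⁅(lam i : FrameGroup n p), mu i⁆⁻¹ * moved l i * ⁅(lam i : FrameGroup n p), mu i⁆

/-- `φ` is the automorphism `ζ_i`. With `γ` the last `γ`, moved to stand just before `λ_i`, and
`c = γ ^ [λ_i, μ_i]`: `γ ↦ c`, `λ_i ↦ λ_i ^ c`, `μ_i ↦ μ_i ^ c`, the rest of the frame is fixed. -/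
structure IsZeta (l : Fin n) (i : Fin p) (φ : MulAut (FrameGroup n p)) : Prop where
  last : l.val + 1 = n
  map_moved : φ (moved l i) = zetaConj l i
  map_lam_self : φ (lam i) = (zetaConj l i)⁻¹ * lam i * zetaConj l i
  map_mu_self : φ (mu i) = (zetaConj l i)⁻¹ * mu i * zetaConj l i
  map_gam : ∀ j, j ≠ l → φ (gam j) = gam j
  map_lam : ∀ j, j ≠ i → φ (lam j) = lam j
  map_mu : ∀ j, j ≠ i → φ (mu j) = mu j

/-- The algebraic braid group `Br_{n,p}`. -/
def braidGroup (n p : ℕ) : Subgroup (MulAut (FrameGroup n p)) :=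
  Subgroup.closure
    {φ | (∃ i i', IsSigma i i' φ) ∨ (∃ l i, IsXiLam l i φ) ∨ (∃ l i, IsXiMu l i φ) ∨
      (∃ l i, IsZeta l i φ)}

end FrameGroup

open FrameGroup in
/-- A collection `ℋ = {H_{n,p}}` of admissible automorphism groups. -/
structure AdmissibleCollection where
  grp : ∀ n p : ℕ, Subgroup (MulAut (FrameGroup n p))
  braid_le : ∀ n p, braidGroup n p ≤ grp n p
  conj : ∀ n p, ∀ h ∈ grp n p, ∃ π : Equiv.Perm (Fin n), ∀ i, IsConj (h (gam i)) (gam (π i))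
  map_boundary : ∀ n p, ∀ h ∈ grp n p, h (boundary n p) = boundary n p

/-! ## Equipped groups and covering semigroups -/

/-- An equipment of `G`: a finite ordered list of distinct conjugacy classes `C_1, …, C_m` of `G`,
none of them the class of the identity. -/
structure Equipment (G : Type*) [Group G] where
  m : ℕ
  C : Fin m → ConjClasses G
  injective : Function.Injective C
  one_notMem : ∀ i, (1 : G) ∉ (C i).carrier

namespace Equipment

variable {G : Type*} [Group G]

/-- The set `O = C_1 ⊔ ⋯ ⊔ C_m`. -/
def O (E : Equipment G) : Set G := {g | ∃ i, g ∈ (E.C i).carrier}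

theorem mem_O_of_isConj (E : Equipment G) {g g' : G} (h : IsConj g' g) (hg : g ∈ E.O) :
    g' ∈ E.O := by
  obtain ⟨i, hi⟩ := hg
  refine ⟨i, ?_⟩
  rw [ConjClasses.mem_carrier_iff_mk_eq] at hi ⊢
  rw [← hi, ConjClasses.mk_eq_mk_iff_isConj]
  exact h

theorem conj_mem_O (E : Equipment G) {g : G} (c : G) (hg : g ∈ E.O) : c⁻¹ * g * c ∈ E.O :=
  E.mem_O_of_isConj (isConj_iff.2 ⟨c, by group⟩) hg

/-- The alphabet `{x_g | g ∈ O} ∪ {y_{a,b} | a, b ∈ G}`. -/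
inductive Letter (E : Equipment G) : Type _
  | x (g : G) (hg : g ∈ E.O) : Letter E
  | y (a b : G) : Letter E

/-- An equipped homomorphism from the free group: each `γ_i` is sent into `O`. -/
structure EqHom (E : Equipment G) (n p : ℕ) where
  hom : FrameGroup n p →* G
  mem : ∀ i, hom (FrameGroup.gam i) ∈ E.O

/-- The composition `f ∘ h` of an equipped homomorphism `f` with an automorphism `h` that permutes
the conjugacy classes of the `γ_i`. -/
def EqHom.comp {E : Equipment G} {n p : ℕ} (f : E.EqHom n p) (h : MulAut (FrameGroup n p))
    (hh : ∃ π : Equiv.Perm (Fin n), ∀ i, IsConj (h (FrameGroup.gam i)) (FrameGroup.gam (π i))) :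
    E.EqHom n p where
  hom := f.hom.comp h.toMonoidHom
  mem i := by
    obtain ⟨π, hπ⟩ := hh
    exact E.mem_O_of_isConj (f.hom.map_isConj (hπ i)) (f.mem (π i))

/-- The word `x_{g_1} ⋯ x_{g_n} y_{a_1,b_1} ⋯ y_{a_p,b_p}` with `g_i = f(γ_i)`, `a_j = f(λ_j)`,
`b_j = f(μ_j)`. -/
def EqHom.word {E : Equipment G} {n p : ℕ} (f : E.EqHom n p) : FreeMonoid E.Letter :=
  FreeMonoid.ofList
    ((List.ofFn fun i : Fin n => Letter.x (f.hom (FrameGroup.gam i)) (f.mem i)) ++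
      List.ofFn fun j : Fin p => Letter.y (f.hom (FrameGroup.lam j)) (f.hom (FrameGroup.mu j)))

/-- The defining relations of the covering semigroup of `ℋ`:
`x_g · y_{a,b} = y_{a,b} · x_{g ^ [a,b]}`, and the relation of every `h ∈ H_{n,p}`, which
replaces each of `g_i, a_j, b_j` (the values of `f` at the generators `γ_i, λ_j, μ_j`) by the value
of `f` at the image of that generator under `h`. -/
inductive Rel (E : Equipment G) (H : AdmissibleCollection) :
    FreeMonoid E.Letter → FreeMonoid E.Letter → Prop
  | swap (g : G) (hg : g ∈ E.O) (a b : G) :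
      Rel E H (FreeMonoid.of (Letter.x g hg) * FreeMonoid.of (Letter.y a b))
        (FreeMonoid.of (Letter.y a b) *
          FreeMonoid.of (Letter.x (⁅a, b⁆⁻¹ * g * ⁅a, b⁆) (E.conj_mem_O ⁅a, b⁆ hg)))
  | admis (n p : ℕ) (h : MulAut (FrameGroup n p)) (hh : h ∈ H.grp n p) (f : E.EqHom n p) :
      Rel E H f.word (f.comp h (H.conj n p h hh)).word

/-- The admissible covering semigroup over `(G, O)` defined by `ℋ` (with unity adjoined). -/
abbrev Covering (E : Equipment G) (H : AdmissibleCollection) : Type _ := PresentedMonoid (E.Rel H)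

/-! ### The product homomorphism -/

/-- `x_g ↦ g`, `y_{a,b} ↦ [a, b]`. -/
def Letter.prod {E : Equipment G} : E.Letter → G
  | .x g _ => g
  | .y a b => ⁅a, b⁆

theorem EqHom.lift_prod_word {E : Equipment G} {n p : ℕ} (f : E.EqHom n p) :
    FreeMonoid.lift Letter.prod f.word = f.hom (FrameGroup.boundary n p) := by
  simp [EqHom.word, FrameGroup.boundary, FreeMonoid.lift_apply, List.map_ofFn, map_list_prod,
    Function.comp_def, Letter.prod, map_commutatorElement]

/-- The product homomorphism `α`. -/
def prodHom (E : Equipment G) (H : AdmissibleCollection) : E.Covering H →* G :=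
  PresentedMonoid.lift Letter.prod (by
    intro u v huv
    cases huv with
    | swap g hg a b => simp [Letter.prod]; group
    | admis n p h hh f =>
      rw [EqHom.lift_prod_word, EqHom.lift_prod_word]
      exact (congrArg f.hom (H.map_boundary n p h hh)).symm)

/-! ### Type and genus -/

open Classical in
/-- `x_g` with `g ∈ C_i` has type the `i`-th basis vector, `y_{a,b}` has type `0`. -/
noncomputable def Letter.type {E : Equipment G} : E.Letter → Multiplicative (Fin E.m → ℕ)
  | .x g _ => Multiplicative.ofAdd fun i => if g ∈ (E.C i).carrier then 1 else 0
  | .y _ _ => 1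

/-- `x_g` has genus `0`, `y_{a,b}` has genus `1`. -/
def Letter.genus {E : Equipment G} : E.Letter → Multiplicative ℕ
  | .x _ _ => 1
  | .y _ _ => Multiplicative.ofAdd 1

open Classical in
theorem Letter.type_congr {E : Equipment G} {g g' : G} (hg : g ∈ E.O) (hg' : g' ∈ E.O)
    (h : IsConj g g') : (Letter.x g hg).type = (Letter.x g' hg').type := by
  have key : ∀ i, g ∈ (E.C i).carrier ↔ g' ∈ (E.C i).carrier := fun i => by
    rw [ConjClasses.mem_carrier_iff_mk_eq, ConjClasses.mem_carrier_iff_mk_eq,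
      ConjClasses.mk_eq_mk_iff_isConj.2 h]
  exact congrArg Multiplicative.ofAdd (funext fun i => if_congr (key i) rfl rfl)

/-- The type homomorphism `τ`. -/
noncomputable def typeHom (E : Equipment G) (H : AdmissibleCollection) :
    E.Covering H →* Multiplicative (Fin E.m → ℕ) :=
  PresentedMonoid.lift Letter.type (by
    intro u v huv
    cases huv with
    | swap g hg a b =>
      simp only [map_mul, FreeMonoid.lift_eval_of]
      rw [mul_comm]
      congr 1
      exact Letter.type_congr _ _ (isConj_iff.2 ⟨⁅a, b⁆⁻¹, by group⟩)
    | admis n p h hh f =>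
      obtain ⟨π, hπ⟩ := H.conj n p h hh
      simp only [EqHom.word, FreeMonoid.lift_apply, FreeMonoid.toList_ofList, List.map_append,
        List.prod_append, List.map_ofFn, List.prod_ofFn]
      congr 1
      rw [← Equiv.prod_comp π]
      refine Finset.prod_congr rfl fun i _ => ?_
      exact Letter.type_congr _ _ (f.hom.map_isConj (hπ i)).symm)

/-- The genus homomorphism. -/
def genusHom (E : Equipment G) (H : AdmissibleCollection) : E.Covering H →* Multiplicative ℕ :=
  PresentedMonoid.lift Letter.genus (by
    intro u v huv
    cases huv with
    | swap g hg a b => simp [Letter.genus]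
    | admis n p h hh f =>
      simp only [EqHom.word, FreeMonoid.lift_apply, FreeMonoid.toList_ofList, List.map_append,
        List.prod_append, List.map_ofFn]
      rfl)

variable {E : Equipment G} {H : AdmissibleCollection}

/-- The type `τ(s) = (τ_1(s), …, τ_m(s))`. -/
noncomputable def type (s : E.Covering H) : Fin E.m → ℕ := Multiplicative.toAdd (E.typeHom H s)

/-- The genus `g(s)`. -/
def genus (s : E.Covering H) : ℕ := Multiplicative.toAdd (E.genusHom H s)

/-! ### The subgroup `G_s` -/

/-- The group elements in the index of a letter. -/
def Letter.support : E.Letter → Set G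
  | .x g _ => {g}
  | .y a b => {a, b}

/-- The subgroup of `G` generated by the indices of the letters of a word. -/
def wordSubgroup (w : FreeMonoid E.Letter) : Subgroup G :=
  ⨆ z ∈ FreeMonoid.toList w, Subgroup.closure (Letter.support z)

theorem wordSubgroup_mul (u v : FreeMonoid E.Letter) :
    wordSubgroup (u * v) = wordSubgroup u ⊔ wordSubgroup v := by
  simp only [wordSubgroup, FreeMonoid.toList_mul, List.mem_append]
  rw [← iSup_sup_eq]
  exact iSup_congr fun z => iSup_or

theorem wordSubgroup_of (z : E.Letter) :
    wordSubgroup (FreeMonoid.of z) = Subgroup.closure z.support := by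
  simp [wordSubgroup]

theorem EqHom.wordSubgroup_word {n p : ℕ} (f : E.EqHom n p) :
    wordSubgroup f.word = f.hom.range := by
  have hr : f.hom.range = Subgroup.closure (Set.range fun x => f.hom (FreeGroup.of x)) := by
    rw [MonoidHom.range_eq_map, ← FreeGroup.closure_range_of, MonoidHom.map_closure,
      ← Set.range_comp]
    rfl
  apply le_antisymm
  · refine iSup₂_le fun z hz => ?_
    rw [Subgroup.closure_le]
    simp only [EqHom.word, FreeMonoid.toList_ofList, List.mem_append, List.mem_ofFn] at hz
    rcases hz with ⟨i, rfl⟩ | ⟨j, rfl⟩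
    · rintro _ rfl
      exact ⟨_, rfl⟩
    · rintro _ (rfl | rfl)
      · exact ⟨_, rfl⟩
      · exact ⟨_, rfl⟩
  · have key : ∀ z ∈ FreeMonoid.toList f.word, ∀ c ∈ z.support, c ∈ wordSubgroup f.word :=
      fun z hz c hc => (le_iSup₂_of_le (f := fun z _ => Subgroup.closure (Letter.support z))
        z hz le_rfl) (Subgroup.subset_closure hc)
    rw [hr, Subgroup.closure_le]
    rintro _ ⟨(i | j | j), rfl⟩
    · exact key (Letter.x _ (f.mem i)) (by simp [EqHom.word, List.mem_ofFn]) _ rfl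
    · exact key (Letter.y (f.hom (FrameGroup.lam j)) (f.hom (FrameGroup.mu j)))
        (by simp only [EqHom.word, FreeMonoid.toList_ofList, List.mem_append, List.mem_ofFn]
            exact Or.inr ⟨j, rfl⟩) _ (Or.inl rfl)
    · exact key (Letter.y (f.hom (FrameGroup.lam j)) (f.hom (FrameGroup.mu j)))
        (by simp only [EqHom.word, FreeMonoid.toList_ofList, List.mem_append, List.mem_ofFn]
            exact Or.inr ⟨j, rfl⟩) _ (Or.inr rfl)

theorem wordSubgroup_congr {u v : FreeMonoid E.Letter} (huv : conGen (E.Rel H) u v) :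
    wordSubgroup u = wordSubgroup v := by
  have hle : conGen (E.Rel H) ≤
      { r := fun u v => wordSubgroup u = wordSubgroup v
        iseqv := ⟨fun _ => rfl, fun h => h.symm, fun h h' => h.trans h'⟩
        mul' := fun h h' => by simp only [wordSubgroup_mul, h, h'] } := by
    refine Con.conGen_le.2 fun u v huv => ?_
    change wordSubgroup u = wordSubgroup v
    cases huv with
    | swap g hg a b =>
      simp only [wordSubgroup_mul, wordSubgroup_of, Letter.support]
      set A := Subgroup.closure ({a, b} : Set G) with hA
      have ha : a ∈ A := Subgroup.subset_closure (Or.inl rfl)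
      have hb : b ∈ A := Subgroup.subset_closure (Or.inr rfl)
      have hc : ⁅a, b⁆ ∈ A := by
        rw [commutatorElement_def]
        exact A.mul_mem (A.mul_mem (A.mul_mem ha hb) (A.inv_mem ha)) (A.inv_mem hb)
      generalize ⁅a, b⁆ = c at hc
      apply le_antisymm
      · refine sup_le ?_ le_sup_left
        rw [Subgroup.closure_le, Set.singleton_subset_iff]
        set B := A ⊔ Subgroup.closure ({c⁻¹ * g * c} : Set G) with hB
        have hcB : c ∈ B := (le_sup_left : A ≤ B) hc
        have h1 : c⁻¹ * g * c ∈ B :=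
          (le_sup_right : _ ≤ B) (Subgroup.subset_closure rfl)
        have h2 := B.mul_mem (B.mul_mem hcB h1) (B.inv_mem hcB)
        have h3 : c * (c⁻¹ * g * c) * c⁻¹ = g := by group
        rwa [h3] at h2
      · refine sup_le le_sup_right ?_
        rw [Subgroup.closure_le, Set.singleton_subset_iff]
        set B := Subgroup.closure ({g} : Set G) ⊔ A with hB
        have hcB : c ∈ B := (le_sup_right : A ≤ B) hc
        have h1 : g ∈ B := (le_sup_left : _ ≤ B) (Subgroup.subset_closure rfl)
        exact B.mul_mem (B.mul_mem (B.inv_mem hcB) h1) hcB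
    | admis n p h hh f =>
      rw [EqHom.wordSubgroup_word, EqHom.wordSubgroup_word]
      ext c
      constructor
      · rintro ⟨w, rfl⟩
        exact ⟨h.symm w, by simp [EqHom.comp]⟩
      · rintro ⟨w, rfl⟩
        exact ⟨h w, rfl⟩
  exact hle huv

/-- The subgroup `G_s` of `G` generated by all `g_i`, `a_j`, `b_j` in a presentation of `s` as a
product of letters `x_{g_i}` and `y_{a_j,b_j}`. -/
def genSubgroup (s : E.Covering H) : Subgroup G :=
  Quotient.liftOn s wordSubgroup fun _ _ huv => wordSubgroup_congr huv

/-- The elements `z` of the covering semigroup with `α(z) = σ`, `g(z) = p` and `τ(z) = t`. -/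
def solutions (E : Equipment G) (H : AdmissibleCollection) (σ : G) (p : ℕ) (t : Fin E.m → ℕ) :
    Set (E.Covering H) :=
  {z | E.prodHom H z = σ ∧ genus z = p ∧ type z = t}

/-- Those `z` among the solutions that satisfy `G_z = G`. -/
def genSolutions (E : Equipment G) (H : AdmissibleCollection) (σ : G) (p : ℕ)
    (t : Fin E.m → ℕ) : Set (E.Covering H) :=
  {z | z ∈ E.solutions H σ p t ∧ genSubgroup z = ⊤}

end Equipment

/-! In a covering semigroup every `x_g` moves past every element by conjugation, and a power `x_g ^
k` with `g ^ k = 1` is central. The relations of `ξ_λ` and `ξ_μ`, iterated `k` times, show more: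
such a power in front of `m` can be conjugated by each index occurring in the letters of `m`, not
only by the product of `m`. Hence, if the letters of a word generate the group and some `x_g` occurs
often, blocks `x_g ^ N`, with `N` an exponent of the group, can be exchanged for blocks of arbitrary
conjugates. A long supply of letters from the class `C` of `σ₁` thus yields powers of the central
element `W = ∏_{g ∈ C} x_g ^ N`, which has product `1` and generates the whole group
(`BraidSystem.regenerate`).

With this supply any letter of `C` can be produced where it is needed. It conjugates the letters
outside `C` at will, and through `ξ_λ` and `ξ_μ` it multiplies the entries of `y_{a,b}`. So every
`y` becomes `y_{1,1}`, and the letters outside `C` become fixed representatives in a fixed order.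
What remains are words in `C` of given length and product. They are compared in the universal monoid
on `C` (`BraidMonoid.exists_forall_listX_eq`), which involves neither the equipment nor the
admissible groups nor the genus; this is why the threshold depends on the class alone.

Making `W` trivial turns the universal monoid into a central extension of the symmetric group with
an equivariant lift of `C`. An odd element of `C` fixing `a` and `b` commutes with the transposition
of `a` and `b`, and this forces a lift of the transposition to commute with all lifts of its
centralizer (`commute_lift_swap`). So transpositions lift equivariantly, and each lifted letter of
`C` is a fixed central element times a fixed number of lifted transpositions. Words in lifted
transpositions with equal length and product agree (`IsSwapSystem.prod_eq`), so words in `C` agree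
after multiplication by a power of `W`. Long words reduce to finitely many short ones, so one power
serves for all, and long generating words contain it.

Existence is a question about products only: commutators are even, and every permutation of the
right sign is a product of any large number of elements of `C` (`exists_list_prod_eq`). Any solution
therefore yields a generating one, of any genus and over any admissible collection. -/

/-! ### Braid systems and conjugation of central powers -/

/-- A monoid `M` with a product homomorphism to `G` and with elements `X g`, `g ∈ O`, that move
past every element of `M` by conjugation. The subgroup `gen m` plays the role of the subgroup
generated by the letters of `m`. -/
structure PreBraidSystem {G : Type*} [Group G] (O : Set G) (M : Type*) [Monoid M] where
  prod : M →* G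
  X : G → M
  gen : M → Subgroup G
  conj_mem : ∀ g ∈ O, ∀ c : G, c * g * c⁻¹ ∈ O
  prod_X : ∀ g ∈ O, prod (X g) = g
  gen_X : ∀ g ∈ O, gen (X g) = Subgroup.zpowers g
  gen_mul : ∀ m m', gen (m * m') = gen m ⊔ gen m'
  mul_X : ∀ g ∈ O, ∀ m, m * X g = X (prod m * g * (prod m)⁻¹) * m
  commute_pow : ∀ g ∈ O, ∀ k, g ^ k = 1 → ∀ m, Commute (X g ^ k) m

namespace PreBraidSystem

variable {G : Type*} [Group G] {O : Set G} {M : Type*} [Monoid M] (B : PreBraidSystem O M)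

theorem mul_X_pow {g : G} (hg : g ∈ O) (m : M) (k : ℕ) :
    m * B.X g ^ k = B.X (B.prod m * g * (B.prod m)⁻¹) ^ k * m := by
  induction k with
  | zero => simp
  | succ k ih => rw [pow_succ, ← mul_assoc, ih, mul_assoc, B.mul_X g hg, ← mul_assoc, pow_succ]

/-- The elements `h` such that `X g ^ k` in front of `m` can be conjugated by `h` if `g ^ k = 1`. -/
def stab (m : M) : Subgroup G where
  carrier := {h | ∀ g ∈ O, ∀ k, g ^ k = 1 → B.X g ^ k * m = B.X (h * g * h⁻¹) ^ k * m}
  one_mem' := by intro g _ k _; simp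
  mul_mem' := by
    intro a b ha hb g hg k hk
    rw [hb g hg k hk, ha _ (B.conj_mem g hg b) k (by rw [conj_pow, hk]; group)]
    congr 3
    group
  inv_mem' := by
    intro a ha g hg k hk
    rw [ha (a⁻¹ * g * a⁻¹⁻¹) (B.conj_mem g hg a⁻¹) k (by rw [conj_pow, hk]; group)]
    congr 3
    group

/-- The power is central, so it may be carried behind `m`; carrying it back letter by letter
conjugates it by the product of `m`. -/
theorem prod_mem_stab (m : M) : B.prod m ∈ B.stab m := by
  intro g hg k hk
  rw [(B.commute_pow g hg k hk m).eq, B.mul_X_pow hg]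

theorem stab_le_stab_mul_right (m m' : M) : B.stab m ≤ B.stab (m * m') := by
  intro h hh g hg k hk
  rw [← mul_assoc, hh g hg k hk, mul_assoc]

/-- Carrying the power through `m`, conjugating by `h` in front of `m'` and carrying it back
conjugates by `prod m * h * (prod m)⁻¹`. Since `prod m` lies in the stabilizer too, so does `h`. -/
theorem stab_le_stab_mul_left (m m' : M) : B.stab m' ≤ B.stab (m * m') := by
  intro h hh
  have hp : B.prod m ∈ B.stab (m * m') := B.stab_le_stab_mul_right m m' (B.prod_mem_stab m)
  have key : B.prod m * h * (B.prod m)⁻¹ ∈ B.stab (m * m') := by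
    intro g hg k hk
    have hg' := B.conj_mem g hg (B.prod m)⁻¹
    have e := B.mul_X_pow hg' m k
    have e' := B.mul_X_pow (B.conj_mem _ hg' h) m k
    have e₁ : B.prod m * ((B.prod m)⁻¹ * g * (B.prod m)⁻¹⁻¹) * (B.prod m)⁻¹ = g := by group
    rw [e₁] at e
    rw [← mul_assoc, ← e, mul_assoc, hh _ hg' k (by rw [conj_pow, hk]; group), ← mul_assoc, e',
      mul_assoc]
    congr 3
    group
  have := (B.stab (m * m')).mul_mem ((B.stab (m * m')).mul_mem
    ((B.stab (m * m')).inv_mem hp) key) hp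
  simpa [mul_assoc] using this

end PreBraidSystem

/-- A braid system in which the letters of `m` conjugate every `X g ^ k` with `g ^ k = 1`. -/
structure BraidSystem {G : Type*} [Group G] (O : Set G) (M : Type*) [Monoid M] extends
    PreBraidSystem O M where
  gen_le_stab : ∀ m, gen m ≤ toPreBraidSystem.stab m

namespace BraidSystem

section General

variable {G : Type*} [Group G] {O : Set G} {M : Type*} [Monoid M] (B : BraidSystem O M)

theorem conj_mem' {G : Type*} [Group G] {O : Set G} {M : Type*} [Monoid M]
    (B : BraidSystem O M) {g : G} (hg : g ∈ O) (c : G) : c⁻¹ * g * c ∈ O := by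
  simpa using B.conj_mem g hg c⁻¹

theorem X_mul {g : G} (hg : g ∈ O) (m : M) :
    B.X g * m = m * B.X ((B.prod m)⁻¹ * g * B.prod m) := by
  rw [B.mul_X _ (B.conj_mem' hg _)]
  congr 2
  group

/-- The product of the elements `X g` over a list. -/
def listX (l : List G) : M := (l.map B.X).prod

@[simp] theorem listX_nil : B.listX [] = 1 := rfl

@[simp] theorem listX_cons (g : G) (l : List G) : B.listX (g :: l) = B.X g * B.listX l := by
  simp [listX]

@[simp] theorem listX_append (l l' : List G) :
    B.listX (l ++ l') = B.listX l * B.listX l' := by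
  simp [listX]

@[simp] theorem listX_replicate (n : ℕ) (g : G) :
    B.listX (List.replicate n g) = B.X g ^ n := by
  simp [listX]

theorem prod_listX {l : List G} (hl : ∀ g ∈ l, g ∈ O) : B.prod (B.listX l) = l.prod := by
  induction l with
  | nil => simp
  | cons g l ih =>
    simp only [List.forall_mem_cons] at hl
    simp [B.prod_X g hl.1, ih hl.2]

theorem gen_pow {m : M} {n : ℕ} (hn : n ≠ 0) : B.gen (m ^ n) = B.gen m := by
  induction n with
  | zero => exact absurd rfl hn
  | succ n ih =>
    rcases Nat.eq_zero_or_pos n with rfl | h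
    · simp
    · rw [pow_succ, B.gen_mul, ih h.ne', sup_idem]

theorem le_gen_mul_left (m m' : M) : B.gen m ≤ B.gen (m * m') := by
  rw [B.gen_mul]; exact le_sup_left

open Classical in
/-- All occurrences of a given `X g` can be moved to the front. -/
theorem exists_listX_eq_pow_mul (C : Finset G) (hC : ∀ g ∈ C, ∀ c : G, c * g * c⁻¹ ∈ C)
    (hCO : ∀ g ∈ C, g ∈ O) (g : G) (l : List G) (hl : ∀ h ∈ l, h ∈ C) :
    ∃ l' : List G, (∀ h ∈ l', h ∈ C) ∧ l'.length + l.count g = l.length ∧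
      B.listX l = B.X g ^ l.count g * B.listX l' := by
  induction l with
  | nil => exact ⟨[], by simp⟩
  | cons h l ih =>
    simp only [List.forall_mem_cons] at hl
    obtain ⟨l', hl', hlen, heq⟩ := ih hl.2
    by_cases hgh : h = g
    · subst hgh
      refine ⟨l', hl', ?_, ?_⟩
      · simp; omega
      · simp [heq, pow_succ', mul_assoc]
    · refine ⟨((B.prod (B.X g ^ l.count g))⁻¹ * h * B.prod (B.X g ^ l.count g)) :: l', ?_, ?_, ?_⟩
      · simp only [List.forall_mem_cons]
        refine ⟨?_, hl'⟩
        simpa using hC h hl.1 (B.prod (B.X g ^ l.count g))⁻¹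
      · simp [hgh]; omega
      · rw [listX_cons, heq, ← mul_assoc, B.X_mul (hCO h hl.1)]
        simp [hgh, mul_assoc]

end General

/-! ### The central element `W` and its production from long words -/

/-- The list in which every element of `C` occurs `N` times. -/
noncomputable def wList {G : Type*} (C : Finset G) (N : ℕ) : List G :=
  C.toList.flatMap (List.replicate N)

theorem mem_wList {G : Type*} {C : Finset G} {N : ℕ} (hN : N ≠ 0) {g : G} :
    g ∈ wList C N ↔ g ∈ C := by
  simp [wList, List.mem_flatMap, List.mem_replicate, hN]

theorem mem_of_mem_wList {G : Type*} {C : Finset G} {N : ℕ} {g : G} (hg : g ∈ wList C N) :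
    g ∈ C := by
  simp only [wList, List.mem_flatMap, List.mem_replicate, Finset.mem_toList] at hg
  obtain ⟨a, ha, -, rfl⟩ := hg
  exact ha

theorem length_wList {G : Type*} (C : Finset G) (N : ℕ) : (wList C N).length = C.card * N := by
  simp [wList, List.length_flatMap]

theorem prod_wList {G : Type*} [Group G] (C : Finset G) {N : ℕ} (hN : ∀ g : G, g ^ N = 1) :
    (wList C N).prod = 1 := by
  rw [wList]
  induction C.toList with
  | nil => simp
  | cons a l ih => simp [ih, hN]

section Fixed

variable {G : Type*} [Group G] {O : Set G} {M : Type*} [Monoid M] (B : BraidSystem O M)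
  {C : Finset G} {N : ℕ}

/-- The central element `∏_{g ∈ C} X g ^ N`. -/
noncomputable def W (C : Finset G) (N : ℕ) : M := B.listX (wList C N)

theorem W_eq : B.W C N = (C.toList.map fun g => B.X g ^ N).prod := by
  rw [W, wList]
  induction C.toList with
  | nil => simp
  | cons a l ih => simp [ih]

theorem W_pow_eq (K : ℕ) :
    B.W C N ^ K = ((List.replicate K C.toList).flatten.map fun g => B.X g ^ N).prod := by
  rw [W_eq]
  induction K with
  | zero => simp
  | succ K ih => rw [pow_succ', ih, List.replicate_succ]; simp

theorem commute_W (hN : ∀ g : G, g ^ N = 1) (hCO : ∀ g ∈ C, g ∈ O) (m : M) :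
    Commute (B.W C N) m := by
  rw [W_eq]
  have : ∀ g ∈ C.toList, g ∈ O := fun g hg => hCO g (by simpa using hg)
  generalize C.toList = L at this ⊢
  induction L with
  | nil => simp
  | cons a l ih =>
    simp only [List.forall_mem_cons] at this
    simpa using (B.commute_pow a this.1 N (hN a) m).mul_left (ih this.2)

theorem prod_W (hN : ∀ g : G, g ^ N = 1) (hCO : ∀ g ∈ C, g ∈ O) : B.prod (B.W C N) = 1 := by
  rw [W, B.prod_listX fun g hg => hCO g (mem_of_mem_wList hg), prod_wList C hN]

/-- Every letter of `C` divides `W`. This later provides inverses in the quotient by `W` and gives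
access to a chosen letter. -/
theorem exists_W_eq_X_mul (hC : ∀ g ∈ C, ∀ c : G, c * g * c⁻¹ ∈ C) (hCO : ∀ g ∈ C, g ∈ O)
    (hN0 : N ≠ 0) {g : G} (hg : g ∈ C) :
    ∃ l : List G, (∀ h ∈ l, h ∈ C) ∧ l.length + 1 = (wList C N).length ∧
      B.W C N = B.X g * B.listX l := by
  classical
  obtain ⟨l, hl, hlen, heq⟩ := B.exists_listX_eq_pow_mul C hC hCO g (wList C N)
    fun h hh => mem_of_mem_wList hh
  have hpos : 0 < (wList C N).count g := List.count_pos_iff.2 ((mem_wList hN0).2 hg)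
  obtain ⟨k, hk⟩ := Nat.exists_eq_succ_of_ne_zero hpos.ne'
  refine ⟨List.replicate k g ++ l, ?_, ?_, ?_⟩
  · intro h hh
    rcases List.mem_append.1 hh with hh | hh
    · rw [List.eq_of_mem_replicate hh]; exact hg
    · exact hl h hh
  · simp; omega
  · rw [W, heq, hk]; simp [pow_succ', mul_assoc]

theorem exists_W_eq_mul_X (hC : ∀ g ∈ C, ∀ c : G, c * g * c⁻¹ ∈ C) (hCO : ∀ g ∈ C, g ∈ O)
    (hN : ∀ g : G, g ^ N = 1) (hN0 : N ≠ 0) {g : G} (hg : g ∈ C) :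
    ∃ l : List G, (∀ h ∈ l, h ∈ C) ∧ l.length + 1 = (wList C N).length ∧
      B.W C N = B.listX l * B.X g := by
  obtain ⟨l, hl, hlen, heq⟩ := B.exists_W_eq_X_mul hC hCO hN0 hg
  refine ⟨l, hl, hlen, ?_⟩
  rw [heq, B.X_mul (hCO g hg)]
  congr 2
  have h1 : B.prod (B.listX l) = g⁻¹ := by
    have := B.prod_W hN hCO
    rw [heq, map_mul, B.prod_X g (hCO g hg)] at this
    exact (inv_eq_of_mul_eq_one_right this).symm
  simp [h1]

theorem gen_W (hC : ∀ g ∈ C, ∀ c : G, c * g * c⁻¹ ∈ C) (hCO : ∀ g ∈ C, g ∈ O) (hN0 : N ≠ 0)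
    (hgen : Subgroup.closure (C : Set G) = ⊤) : B.gen (B.W C N) = ⊤ := by
  rw [eq_top_iff, ← hgen, Subgroup.closure_le]
  intro g hg
  obtain ⟨l, -, -, heq⟩ := B.exists_W_eq_X_mul (N := N) hC hCO hN0 hg
  rw [heq]
  apply B.le_gen_mul_left
  rw [B.gen_X g (hCO g hg)]
  exact Subgroup.mem_zpowers g

/-- A power of `X g` long enough can be exchanged for powers of arbitrary conjugates. -/
theorem pow_block_mul (hN : ∀ g : G, g ^ N = 1) (hN0 : N ≠ 0) {g : G} (hg : g ∈ O) (m : M)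
    (hm : B.gen (B.X g * m) = ⊤) (L : List G) (hL : ∀ h ∈ L, IsConj g h) :
    B.X g ^ (N * (L.length + 1)) * m = (L.map fun h => B.X h ^ N).prod * (B.X g ^ N * m) := by
  induction L with
  | nil => simp
  | cons h L ih =>
    simp only [List.forall_mem_cons] at hL
    obtain ⟨c, hc⟩ := isConj_iff.1 hL.1
    have hpos : N * (L.length + 1) ≠ 0 := by positivity
    -- One block more than there are elements in `L`: after splitting off a block, the rest still
    -- contains `X g`, hence generates and conjugates the block by any `c`.
    have htop : B.gen (B.X g ^ (N * (L.length + 1)) * m) = ⊤ := by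
      rw [B.gen_mul, B.gen_pow hpos, ← B.gen_mul, hm]
    have := B.gen_le_stab (B.X g ^ (N * (L.length + 1)) * m) (by simp [htop] : c ∈ _) g hg N (hN g)
    rw [List.map_cons, List.prod_cons, mul_assoc, ← ih hL.2, ← hc, ← this, ← mul_assoc, ← pow_add,
      List.length_cons]
    congr 2
    ring

/-- Enough letters from a conjugacy class `C` produce any power of `W`. -/
theorem regenerate (hC : ∀ g ∈ C, ∀ c : G, c * g * c⁻¹ ∈ C) (hCO : ∀ g ∈ C, g ∈ O)
    (hconj : ∀ g ∈ C, ∀ h ∈ C, IsConj g h) (hne : C.Nonempty)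
    (hN : ∀ g : G, g ^ N = 1) (hN0 : N ≠ 0) (K : ℕ) (l : List G) (hl : ∀ g ∈ l, g ∈ C)
    (hlen : C.card * (N * (K * C.card + 1)) ≤ l.length) (m : M)
    (hm : B.gen (B.listX l * m) = ⊤) :
    ∃ l' : List G, (∀ g ∈ l', g ∈ C) ∧ l'.length + K * (wList C N).length = l.length ∧
      B.listX l * m = B.W C N ^ K * B.listX l' * m := by
  classical
  -- Pigeonhole. The frequent letter provides `K * C.card` blocks, one for each factor of `W ^ K`,
  -- and a further block that is kept.
  obtain ⟨g, hg, hcount⟩ : ∃ g ∈ C, N * (K * C.card + 1) ≤ l.count g := by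
    refine Finset.exists_le_of_sum_le hne ?_
    rw [Finset.sum_const, smul_eq_mul]
    refine hlen.trans ?_
    rw [← List.sum_toFinset_count_eq_length]
    exact Finset.sum_le_sum_of_subset fun x hx => hl x (by simpa using hx)
  obtain ⟨l₁, hl₁, hlen₁, heq⟩ := B.exists_listX_eq_pow_mul C hC hCO g l hl
  obtain ⟨k, hk⟩ := Nat.exists_eq_add_of_le hcount
  set L := (List.replicate K C.toList).flatten with hLdef
  have hLlen : L.length = K * C.card := by simp [hLdef]
  have hL : ∀ h ∈ L, IsConj g h := fun h hh => hconj g hg h (by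
    simp only [hLdef, List.mem_flatten, List.mem_replicate] at hh
    obtain ⟨_, ⟨-, rfl⟩, h2⟩ := hh
    simpa using h2)
  have hpos : N * (K * C.card + 1) + k ≠ 0 := by positivity
  have hgen : B.gen (B.X g * (B.X g ^ k * B.listX l₁ * m)) = ⊤ := by
    rw [← hm, heq, hk, ← mul_assoc, ← mul_assoc, ← pow_succ', mul_assoc, mul_assoc, B.gen_mul,
      B.gen_mul (_ ^ (_ + k)), B.gen_pow hpos, B.gen_pow (Nat.succ_ne_zero k)]
  have key := B.pow_block_mul hN hN0 (hCO g hg) _ hgen L hL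
  refine ⟨List.replicate (N + k) g ++ l₁, ?_, ?_, ?_⟩
  · intro h hh
    rcases List.mem_append.1 hh with hh | hh
    · rw [List.eq_of_mem_replicate hh]; exact hg
    · exact hl₁ h hh
  · rw [length_wList]
    simp only [List.length_append, List.length_replicate]
    rw [← hlen₁, hk]; ring
  · rw [heq, hk, W_pow_eq, ← hLdef, ← hLlen, pow_add, listX_append, listX_replicate, pow_add]
    simp only [mul_assoc] at key ⊢
    exact key

/-! ### Replacing letters by conjugates -/

/-- `w₂` can replace `w₁` at the cost of changing a sufficiently long list of elements of `C`
in front of it. -/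
def Replace (C : Finset G) (T : ℕ) (w₁ w₂ : List G) : Prop :=
  ∀ (l : List G) (m : M), (∀ g ∈ l, g ∈ C) → T ≤ l.length →
    B.gen (B.listX l * B.listX w₁ * m) = ⊤ →
    ∃ l' : List G, (∀ g ∈ l', g ∈ C) ∧ l'.length = l.length ∧
      B.listX l * B.listX w₁ * m = B.listX l' * B.listX w₂ * m

namespace Replace

variable {B} {T : ℕ}

theorem refl (w : List G) : B.Replace C T w w := fun l _ hl _ _ => ⟨l, hl, rfl, rfl⟩

theorem trans {w₁ w₂ w₃ : List G} (h : B.Replace C T w₁ w₂) (h' : B.Replace C T w₂ w₃) :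
    B.Replace C T w₁ w₃ := by
  intro l m hl hT htop
  obtain ⟨l', hl', hlen, heq⟩ := h l m hl hT htop
  obtain ⟨l'', hl'', hlen', heq'⟩ := h' l' m hl' (by omega) (heq ▸ htop)
  exact ⟨l'', hl'', hlen'.trans hlen, heq.trans heq'⟩

end Replace

/-- The length from which on a list of elements of `C` produces `W`. -/
def bound (C : Finset G) (N K : ℕ) : ℕ := C.card * (N * (K * C.card + 1))

/-- Conditions on `C` and `N` under which letters can be replaced by their conjugates. -/
structure Good (O : Set G) (C : Finset G) (N : ℕ) : Prop where
  conj_mem : ∀ g ∈ C, ∀ c : G, c * g * c⁻¹ ∈ C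
  subset : ∀ g ∈ C, g ∈ O
  isConj : ∀ g ∈ C, ∀ h ∈ C, IsConj g h
  nonempty : C.Nonempty
  pow_eq_one : ∀ g : G, g ^ N = 1
  ne_zero : N ≠ 0
  closure : Subgroup.closure (C : Set G) = ⊤

/-- Induction over a group of finite exponent generated by `C`. -/
theorem Good.induction (hG : Good O C N) {p : G → Prop} (one : p 1) (mem : ∀ g ∈ C, p g)
    (mul : ∀ g h, p g → p h → p (g * h)) (g : G) : p g := by
  have hpow : ∀ h, p h → ∀ n : ℕ, p (h ^ n) := fun h hh n => by
    induction n with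
    | zero => simpa using one
    | succ n ih => rw [pow_succ]; exact mul _ _ ih hh
  have hg : g ∈ Subgroup.closure (C : Set G) := hG.closure ▸ Subgroup.mem_top g
  induction hg using Subgroup.closure_induction with
  | mem x hx => exact mem x hx
  | one => exact one
  | mul x y _ _ hx hy => exact mul x y hx hy
  | inv x _ hx =>
    have : x⁻¹ = x ^ (N - 1) := by
      obtain ⟨k, rfl⟩ := Nat.exists_eq_succ_of_ne_zero hG.ne_zero
      have := hG.pow_eq_one x
      rw [pow_succ] at this
      simpa using (eq_inv_of_mul_eq_one_left this).symm
    rw [this]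
    exact hpow x hx _

variable (hG : Good O C N)
include hG

/-- A copy of `W` is produced, moved next to `m` by centrality, and spelled so that it ends in `X
g`. Thus any desired letter of `C` is available directly before `m`. -/
theorem regenerate_one (l : List G) (hl : ∀ g ∈ l, g ∈ C) (hlen : bound C N 1 ≤ l.length) (m : M)
    (hm : B.gen (B.listX l * m) = ⊤) {g : G} (hg : g ∈ C) :
    ∃ l' : List G, (∀ g ∈ l', g ∈ C) ∧ l'.length + 1 = l.length ∧
      B.listX l * m = B.listX l' * (B.X g * m) := by
  obtain ⟨l', hl', hlen', heq⟩ := B.regenerate hG.conj_mem hG.subset hG.isConj hG.nonempty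
    hG.pow_eq_one hG.ne_zero 1 l hl hlen m hm
  obtain ⟨l₂, hl₂, hlen₂, heq₂⟩ := B.exists_W_eq_mul_X hG.conj_mem hG.subset hG.pow_eq_one
    hG.ne_zero hg
  refine ⟨l' ++ l₂, ?_, ?_, ?_⟩
  · intro h hh
    exact (List.mem_append.1 hh).elim (hl' h) (hl₂ h)
  · simp; omega
  · rw [heq, pow_one, (B.commute_W hG.pow_eq_one hG.subset _).eq, heq₂]
    simp [mul_assoc]

theorem gen_W_mul (m : M) : B.gen (B.W C N * m) = ⊤ := by
  rw [B.gen_mul, B.gen_W hG.conj_mem hG.subset hG.ne_zero hG.closure, top_sup_eq]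

namespace Replace

variable {B}

/-- With `X g` produced beside `X h` and `k = g h g⁻¹`, two braid moves give `X g * X h = X k * X g
= X (k g k⁻¹) * X k`. The first factor is again in `C` and joins the list. -/
theorem conj_of_mem {h : G} (hh : h ∈ O) {g : G} (hg : g ∈ C) :
    B.Replace C (bound C N 1) [h] [g * h * g⁻¹] := by
  intro l m hl hT htop
  obtain ⟨l', hl', hlen, heq⟩ := B.regenerate_one hG l hl hT (B.listX [h] * m)
    (by rwa [← mul_assoc]) hg
  have hk : g * h * g⁻¹ ∈ O := B.conj_mem h hh g
  refine ⟨l' ++ [(g * h * g⁻¹) * g * (g * h * g⁻¹)⁻¹], ?_, ?_, ?_⟩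
  · intro x hx
    rcases List.mem_append.1 hx with hx | hx
    · exact hl' x hx
    · rw [List.mem_singleton.1 hx]; exact hG.conj_mem g hg _
  · simpa using hlen
  · rw [mul_assoc, heq]
    have h1 := B.mul_X h hh (B.X g)
    rw [B.prod_X g (hG.subset g hg)] at h1
    have h2 := B.mul_X g (hG.subset g hg) (B.X (g * h * g⁻¹))
    rw [B.prod_X _ hk] at h2
    simp only [listX_append, listX_cons, listX_nil, mul_one]
    rw [← mul_assoc (B.X g), h1, h2]
    simp only [mul_assoc]

theorem conj {h : G} (hh : h ∈ O) (c : G) :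
    B.Replace C (bound C N 1) [h] [c * h * c⁻¹] := by
  suffices ∀ h ∈ O, B.Replace C (bound C N 1) [h] [c * h * c⁻¹] from this h hh
  refine hG.induction (p := fun c => ∀ h ∈ O, B.Replace C (bound C N 1) [h] [c * h * c⁻¹])
    ?_ ?_ ?_ c
  · intro h _; simpa using refl [h]
  · intro g hg h hh; exact conj_of_mem hG hh hg
  · intro c c' hc hc' h hh
    have := (hc' h hh).trans (hc _ (B.conj_mem h hh c'))
    simpa [mul_assoc] using this

theorem of_isConj {h k : G} (hh : h ∈ O) (hk : IsConj h k) :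
    B.Replace C (bound C N 1) [h] [k] := by
  obtain ⟨c, rfl⟩ := isConj_iff.1 hk
  exact conj hG hh c

/-- The letter `v` is hidden behind `u₁`, where it counts as part of the tail while `u₁` is
replaced. Brought back to the front it is some conjugate of `v`, which is then replaced by `v'`. -/
theorem cons {v v' : G} (hv : v ∈ O) (hvv' : IsConj v v') {u₁ u₂ : List G}
    (h : B.Replace C (bound C N 1) u₁ u₂) :
    B.Replace C (bound C N 1) (v :: u₁) (v' :: u₂) := by
  intro l m hl hT htop
  have e1 := B.X_mul hv (B.listX u₁)
  obtain ⟨l', hl', hlen, heq⟩ := h l (B.X ((B.prod (B.listX u₁))⁻¹ * v * B.prod (B.listX u₁)) * m)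
    hl hT (by rw [← htop, listX_cons, e1]; simp only [mul_assoc])
  have hv1 : (B.prod (B.listX u₁))⁻¹ * v * B.prod (B.listX u₁) ∈ O := B.conj_mem' hv _
  have e2 := B.mul_X _ hv1 (B.listX u₂)
  set x := (B.prod (B.listX u₁))⁻¹ * v * B.prod (B.listX u₁) with hx
  set y := B.prod (B.listX u₂) * x * (B.prod (B.listX u₂))⁻¹ with hy
  have hxv : IsConj x v := isConj_iff.2 ⟨B.prod (B.listX u₁), by rw [hx]; group⟩
  have hyx : IsConj y x := isConj_iff.2 ⟨(B.prod (B.listX u₂))⁻¹, by rw [hy]; group⟩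
  have hyO : y ∈ O := B.conj_mem _ hv1 _
  have e3 : B.listX l * B.listX (v :: u₁) * m
      = B.listX l' * B.listX [y] * (B.listX u₂ * m) := by
    calc B.listX l * B.listX (v :: u₁) * m = B.listX l * B.listX u₁ * (B.X x * m) := by
          rw [listX_cons, e1]; simp only [mul_assoc]
      _ = B.listX l' * (B.listX u₂ * B.X x) * m := by rw [heq]; simp only [mul_assoc]
      _ = _ := by rw [e2]; simp [mul_assoc]
  obtain ⟨l'', hl'', hlen', heq'⟩ := of_isConj hG hyO (hyx.trans (hxv.trans hvv')) l'
    (B.listX u₂ * m) hl' (by omega) (e3 ▸ htop)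
  refine ⟨l'', hl'', hlen'.trans hlen, ?_⟩
  rw [e3, heq']
  simp [mul_assoc]

/-- A braid move exchanges the two letters up to conjugation of `v`, and that conjugation can be
undone. -/
theorem swap {v w : G} (hv : v ∈ O) (hw : w ∈ O) (u : List G) :
    B.Replace C (bound C N 1) (v :: w :: u) (w :: v :: u) := by
  have h1 : B.Replace C (bound C N 1) (v :: w :: u) (w :: (w⁻¹ * v * w) :: u) := by
    intro l m hl _ _
    refine ⟨l, hl, rfl, ?_⟩
    have := B.X_mul hv (B.X w)
    rw [B.prod_X w hw] at this
    simp only [listX_cons, ← mul_assoc] at this ⊢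
    rw [mul_assoc _ (B.X v), this]
    simp only [mul_assoc]
  have h2 : IsConj (w⁻¹ * v * w) v := isConj_iff.2 ⟨w, by group⟩
  exact h1.trans (cons hG hw (IsConj.refl w) (cons hG (B.conj_mem' hv w) h2 (refl u)))

theorem of_perm {w₁ w₂ : List G} (h : w₁.Perm w₂) (hw : ∀ g ∈ w₁, g ∈ O) :
    B.Replace C (bound C N 1) w₁ w₂ := by
  induction h with
  | nil => exact refl _
  | cons x _ ih =>
    simp only [List.forall_mem_cons] at hw
    exact cons hG hw.1 (IsConj.refl x) (ih hw.2)
  | swap x y l =>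
    simp only [List.forall_mem_cons] at hw
    exact swap hG hw.1 hw.2.1 l
  | trans h₁ _ ih₁ ih₂ => exact (ih₁ hw).trans (ih₂ fun g hg => hw g (h₁.mem_iff.2 hg))

theorem map_of_isConj (r : G → G) (hr : ∀ g, IsConj g (r g)) (w : List G) (hw : ∀ g ∈ w, g ∈ O) :
    B.Replace C (bound C N 1) w (w.map r) := by
  induction w with
  | nil => exact refl _
  | cons x w ih =>
    simp only [List.forall_mem_cons] at hw
    exact cons hG hw.1 (hr x) (ih hw.2)

end Replace

end Fixed

end BraidSystem

/-! ### Words in lifted transpositions -/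

section SwapWords

open Equiv

variable {α : Type*} [DecidableEq α] {B : Type*} [Monoid B]

/-- A transposition of two elements of `S`. -/
def IsSwapIn (S : Finset α) (τ : Perm α) : Prop := ∃ x ∈ S, ∃ y ∈ S, x ≠ y ∧ τ = swap x y

theorem prod_apply_of_isSwapIn {S : Finset α} {a : α} (ha : a ∉ S) {l : List (Perm α)}
    (hl : ∀ τ ∈ l, IsSwapIn S τ) : l.prod a = a := by
  induction l with
  | nil => simp
  | cons τ l ih =>
    simp only [List.forall_mem_cons] at hl
    obtain ⟨⟨x, hx, y, hy, -, rfl⟩, hl⟩ := hl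
    rw [List.prod_cons, Perm.mul_apply, ih hl]
    exact swap_apply_of_ne_of_ne (fun h => ha (h ▸ hx)) (fun h => ha (h ▸ hy))

variable {t : Perm α → B} {c : B}

/-- Elements indexed by transpositions that multiply like transpositions up to a central `c`. -/
structure IsSwapSystem (t : Perm α → B) (c : B) : Prop where
  conj : ∀ τ τ' : Perm α, τ.IsSwap → τ'.IsSwap → t τ * t τ' = t τ' * t (τ' * τ * τ')
  sq : ∀ τ : Perm α, τ.IsSwap → t τ * t τ = c
  comm : ∀ b, c * b = b * c

/-- Letters moving `a` are pushed to the right end, where at most one survives: two equal ones give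
the central `c`, and for `j ≠ k` one has `t (j a) * t (k a) = t (j k) * t (j a)`. -/
theorem IsSwapSystem.normal_form (ht : IsSwapSystem t c) {S : Finset α} {a : α} (ha : a ∉ S)
    (l : List (Perm α)) (hl : ∀ τ ∈ l, IsSwapIn (insert a S) τ) :
    ∃ (l' e : List (Perm α)) (m : ℕ), (∀ τ ∈ l', IsSwapIn S τ) ∧
      (e = [] ∨ ∃ j ∈ S, e = [swap j a]) ∧ l.prod = l'.prod * e.prod ∧
      l.length = l'.length + 2 * m + e.length ∧
      (l.map t).prod = c ^ m * (l'.map t).prod * (e.map t).prod := by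
  induction l using List.reverseRecOn with
  | nil => exact ⟨[], [], 0, by simp, Or.inl rfl, by simp, by simp, by simp⟩
  | append_singleton l τ ih =>
    obtain ⟨l', e, m, hl', he, hprod, hlen, heq⟩ := ih fun τ h => hl τ (by simp [h])
    have hτ := hl τ (by simp)
    have hcases : IsSwapIn S τ ∨ ∃ k ∈ S, τ = swap k a := by
      obtain ⟨x, hx, y, hy, hxy, rfl⟩ := hτ
      rcases Finset.mem_insert.1 hx with rfl | hx'
      · rcases Finset.mem_insert.1 hy with rfl | hy'
        · exact absurd rfl hxy
        · exact Or.inr ⟨y, hy', swap_comm _ _⟩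
      · rcases Finset.mem_insert.1 hy with rfl | hy'
        · exact Or.inr ⟨x, hx', rfl⟩
        · exact Or.inl ⟨x, hx', y, hy', hxy, rfl⟩
    have hne : ∀ k ∈ S, k ≠ a := fun k hk h => ha (h ▸ hk)
    rcases he with rfl | ⟨j, hj, rfl⟩
    · rcases hcases with hτ | ⟨k, hk, rfl⟩
      · refine ⟨l' ++ [τ], [], m, ?_, Or.inl rfl, ?_, ?_, ?_⟩
        · simpa [or_imp, forall_and] using ⟨hl', hτ⟩
        · simp [hprod]
        · simp [hlen]; omega
        · simp [heq, mul_assoc]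
      · refine ⟨l', [swap k a], m, hl', Or.inr ⟨k, hk, rfl⟩, ?_, ?_, ?_⟩
        · simp [hprod]
        · simp [hlen]
        · simp [heq, mul_assoc]
    · have hja : (swap j a).IsSwap := ⟨j, a, hne j hj, rfl⟩
      rcases hcases with ⟨x, hx, y, hy, hxy, rfl⟩ | ⟨k, hk, rfl⟩
      · have hconj : swap x y * swap j a * swap x y = swap (swap x y j) a := by
          have := swap_apply_apply (swap x y) j a
          rw [swap_apply_of_ne_of_ne (hne x hx).symm (hne y hy).symm, swap_inv] at this
          exact this.symm
        have hS : swap x y j ∈ S := by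
          rw [swap_apply_def]; split_ifs <;> assumption
        refine ⟨l' ++ [swap x y], [swap (swap x y j) a], m, ?_, Or.inr ⟨_, hS, rfl⟩, ?_, ?_, ?_⟩
        · simpa [or_imp, forall_and] using ⟨hl', x, hx, y, hy, hxy, rfl⟩
        · simp [hprod, ← hconj, mul_assoc]
        · simp [hlen]; omega
        · have := ht.conj _ _ hja ⟨x, y, hxy, rfl⟩
          rw [hconj] at this
          simp [heq, mul_assoc, this]
      · by_cases hkj : k = j
        · subst hkj
          refine ⟨l', [], m + 1, hl', Or.inl rfl, ?_, ?_, ?_⟩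
          · simp [hprod, mul_assoc]
          · simp [hlen]; omega
          · simp only [List.map_append, List.prod_append, heq, List.map_cons, List.map_nil,
              List.prod_cons, List.prod_nil, mul_one]
            rw [mul_assoc, ht.sq _ hja, ← ht.comm, ← mul_assoc, pow_succ']
        · have hconj : swap j a * swap j k * swap j a = swap k a := by
            have := swap_apply_apply (swap j a) j k
            rw [swap_apply_of_ne_of_ne hkj (hne k hk), swap_apply_left, swap_inv] at this
            rw [← this, swap_comm]
          refine ⟨l' ++ [swap j k], [swap j a], m, ?_, Or.inr ⟨j, hj, rfl⟩, ?_, ?_, ?_⟩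
          · simpa [or_imp, forall_and] using ⟨hl', j, hj, k, hk, Ne.symm hkj, rfl⟩
          · simp [hprod, ← hconj, mul_assoc]
          · simp [hlen]; omega
          · have := ht.conj (swap j k) (swap j a) ⟨j, k, Ne.symm hkj, rfl⟩ hja
            rw [hconj] at this
            simp [heq, mul_assoc, this]

/-- Induction on the support. In normal form the word before the final letter fixes `a`, so the
final letter is determined by which point the product sends to `a`; cancelling it leaves words on
fewer points. The powers of `c` absorb the squares that the normal form creates. -/
theorem IsSwapSystem.pow_mul_prod_eq (ht : IsSwapSystem t c) (S : Finset α) :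
    ∀ (l₁ l₂ : List (Perm α)) (m₁ m₂ : ℕ), (∀ τ ∈ l₁, IsSwapIn S τ) → (∀ τ ∈ l₂, IsSwapIn S τ) →
      l₁.prod = l₂.prod → l₁.length + 2 * m₁ = l₂.length + 2 * m₂ →
      c ^ m₁ * (l₁.map t).prod = c ^ m₂ * (l₂.map t).prod := by
  induction S using Finset.induction_on with
  | empty =>
    intro l₁ l₂ m₁ m₂ h₁ h₂ _ hlen
    have hnil : ∀ l : List (Perm α), (∀ τ ∈ l, IsSwapIn ∅ τ) → l = [] := fun l hl =>
      List.eq_nil_iff_forall_not_mem.2 fun τ hτ => by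
        obtain ⟨x, hx, -⟩ := hl τ hτ
        simp at hx
    rw [hnil l₁ h₁, hnil l₂ h₂] at hlen ⊢
    have : m₁ = m₂ := by simpa using hlen
    rw [this]
  | insert a S ha ih =>
    intro l₁ l₂ m₁ m₂ h₁ h₂ hprod hlen
    obtain ⟨l₁', e₁, n₁, hl₁', he₁, hp₁, hlen₁, heq₁⟩ := ht.normal_form ha l₁ h₁
    obtain ⟨l₂', e₂, n₂, hl₂', he₂, hp₂, hlen₂, heq₂⟩ := ht.normal_form ha l₂ h₂
    have hf₁ := prod_apply_of_isSwapIn ha hl₁'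
    have hf₂ := prod_apply_of_isSwapIn ha hl₂'
    have he : e₁ = e₂ := by
      have hpp : l₁'.prod * e₁.prod = l₂'.prod * e₂.prod := by rw [← hp₁, ← hp₂, hprod]
      rcases he₁ with rfl | ⟨j, hj, rfl⟩ <;> rcases he₂ with rfl | ⟨k, hk, rfl⟩
      · rfl
      · have h3 : (l₂'.prod * swap k a) k = (l₂'.prod * swap k a) a := by
          rw [Perm.mul_apply, swap_apply_left, hf₂]
          simpa [hf₁] using congrArg (fun f : Perm α => f a) hpp
        exact absurd ((Equiv.injective _ h3) ▸ hk) ha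
      · have h3 : (l₁'.prod * swap j a) j = (l₁'.prod * swap j a) a := by
          rw [Perm.mul_apply, swap_apply_left, hf₁]
          simpa [hf₂] using (congrArg (fun f : Perm α => f a) hpp).symm
        exact absurd ((Equiv.injective _ h3) ▸ hj) ha
      · have h3 : (l₁'.prod * swap j a) j = (l₁'.prod * swap j a) k := by
          simp only [List.prod_cons, List.prod_nil, mul_one] at hpp
          rw [Perm.mul_apply, swap_apply_left, hf₁, hpp, Perm.mul_apply, swap_apply_left, hf₂]
        rw [(Equiv.injective _ h3)]
    subst he
    have hpp : l₁'.prod = l₂'.prod := mul_right_cancel (hp₁.symm.trans (hprod.trans hp₂))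
    have := ih l₁' l₂' (m₁ + n₁) (m₂ + n₂) hl₁' hl₂' hpp (by omega)
    rw [heq₁, heq₂, ← mul_assoc, ← mul_assoc, ← mul_assoc, ← mul_assoc, ← pow_add, ← pow_add, this]

/-- Words in a swap system of the same length over the same permutation are equal. -/
theorem IsSwapSystem.prod_eq [Fintype α] (ht : IsSwapSystem t c) {l₁ l₂ : List (Perm α)}
    (h₁ : ∀ τ ∈ l₁, τ.IsSwap) (h₂ : ∀ τ ∈ l₂, τ.IsSwap) (hprod : l₁.prod = l₂.prod)
    (hlen : l₁.length = l₂.length) : (l₁.map t).prod = (l₂.map t).prod := by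
  have : ∀ τ : Perm α, τ.IsSwap → IsSwapIn Finset.univ τ := fun τ ⟨x, y, hxy, h⟩ =>
    ⟨x, Finset.mem_univ x, y, Finset.mem_univ y, hxy, h⟩
  simpa using ht.pow_mul_prod_eq Finset.univ l₁ l₂ 0 0 (fun τ h => this τ (h₁ τ h))
    (fun τ h => this τ (h₂ τ h)) hprod (by simpa using hlen)

end SwapWords

/-! ### Central extensions of the symmetric group -/

section CentralExtension

open Equiv

/-- With commuting values, all transpositions have the same image, whose square is `1`, so `F`
factors through the sign. Being trivial on one odd element it is trivial. -/
theorem Equiv.Perm.hom_eq_one_of_sign_eq_neg_one {β A : Type*} [Fintype β] [DecidableEq β]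
    [Group A] (F : Perm β →* A) (hcomm : ∀ σ τ, F σ * F τ = F τ * F σ) {g : Perm β} (hg : Perm.sign g = -1) (hF : F g = 1)
    (σ : Perm β) : F σ = 1 := by
  have hconj : ∀ τ τ' : Perm β, τ.IsSwap → τ'.IsSwap → F τ = F τ' := by
    rintro _ _ ⟨x, y, hxy, rfl⟩ ⟨z, w, hzw, rfl⟩
    obtain ⟨c, hc⟩ := isConj_iff.1 (Perm.isConj_swap hxy hzw)
    rw [← hc, map_mul, hcomm, ← map_mul, inv_mul_cancel_left]
  have hsq : ∀ τ : Perm β, τ.IsSwap → F τ * F τ = 1 := by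
    rintro _ ⟨x, y, -, rfl⟩
    rw [← map_mul, swap_mul_self, map_one]
  have key : ∀ τ : Perm β, τ.IsSwap → ∀ σ : Perm β, F σ = if Perm.sign σ = 1 then 1 else F τ := by
    intro τ hτ σ
    induction σ using Perm.swap_induction_on with
    | one => simp
    | swap_mul f x y hxy ih =>
      rw [map_mul, ih, hconj (swap x y) τ ⟨x, y, hxy, rfl⟩ hτ, map_mul, Perm.sign_swap hxy]
      rcases Int.units_eq_one_or (Perm.sign f) with h | h <;> simp [h, hsq τ hτ]
  have hswap : ∀ τ : Perm β, τ.IsSwap → F τ = 1 := by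
    intro τ hτ
    have := key τ hτ g
    rw [hF, hg] at this
    simpa using this.symm
  induction σ using Perm.swap_induction_on with
  | one => simp
  | swap_mul f x y hxy ih => rw [map_mul, ih, hswap _ ⟨x, y, hxy, rfl⟩, mul_one]

variable {α : Type*} [Fintype α] [DecidableEq α] {Q : Type*} [Group Q]

/-- If an odd permutation fixing `a` and `b` has a lift that commutes with a lift of `swap a b`,
then the lift of `swap a b` commutes with the preimage of the centralizer of `swap a b`. -/
theorem commute_lift_swap {π : Q →* Perm α} (hπ : Function.Surjective π)
    (hker : ∀ k, π k = 1 → ∀ q, k * q = q * k) {a b : α} (hab : a ≠ b) {t₀ : Q}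
    (ht₀ : π t₀ = swap a b) {q₀ : Q} (hq₀ : Perm.sign (π q₀) = -1) (ha : π q₀ a = a)
    (hb : π q₀ b = b) (hcomm : q₀ * t₀ = t₀ * q₀) (q : Q)
    (hq : π q * swap a b = swap a b * π q) : q * t₀ = t₀ * q := by
  classical
  let p : α → Prop := fun x => x ≠ a ∧ x ≠ b
  -- A set-theoretic section over the permutations fixing `a` and `b`; the failure of
  -- multiplicativity is harmless because the commutator with `t₀` ignores the kernel.
  let s : Perm (Subtype p) → Q := fun σ => Function.surjInv hπ (Perm.ofSubtype σ)
  have hs : ∀ σ, π (s σ) = Perm.ofSubtype σ := fun σ => Function.surjInv_eq hπ _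
  have hfix : ∀ σ : Perm (Subtype p), π (s σ) * swap a b * (π (s σ))⁻¹ = swap a b := by
    intro σ
    rw [hs, ← swap_apply_apply, Perm.ofSubtype_apply_of_not_mem, Perm.ofSubtype_apply_of_not_mem]
    · simp [p]
    · simp [p]
  have hcen : ∀ σ, s σ * t₀ * (s σ)⁻¹ * t₀⁻¹ ∈ Subgroup.center Q := by
    intro σ
    rw [Subgroup.mem_center_iff]
    intro g
    refine (hker _ ?_ g).symm
    rw [map_mul, map_mul, map_mul, map_inv, map_inv, ht₀, hfix, mul_inv_cancel]
  -- the commutator depends only on the image in the symmetric group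
  have hdep : ∀ q q' : Q, π q = π q' → q * t₀ * q⁻¹ = q' * t₀ * q'⁻¹ := by
    intro q q' h
    have hk : π (q'⁻¹ * q) = 1 := by simp [h]
    have := hker _ hk t₀
    calc q * t₀ * q⁻¹ = q' * ((q'⁻¹ * q) * t₀) * q⁻¹ := by group
      _ = q' * (t₀ * (q'⁻¹ * q)) * q⁻¹ := by rw [this]
      _ = _ := by group
  -- Since these commutators are central, taking the commutator with `t₀` is a homomorphism; `q₀`
  -- provides an odd element on which it vanishes.
  let F : Perm (Subtype p) →* Q := MonoidHom.mk' (fun σ => s σ * t₀ * (s σ)⁻¹ * t₀⁻¹) (by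
      intro σ τ
      change s (σ * τ) * t₀ * (s (σ * τ))⁻¹ * t₀⁻¹
        = (s σ * t₀ * (s σ)⁻¹ * t₀⁻¹) * (s τ * t₀ * (s τ)⁻¹ * t₀⁻¹)
      rw [hdep (s (σ * τ)) (s σ * s τ) (by simp [hs])]
      have h := Subgroup.mem_center_iff.1 (hcen τ)
      calc s σ * s τ * t₀ * (s σ * s τ)⁻¹ * t₀⁻¹
          = s σ * (s τ * t₀ * (s τ)⁻¹ * t₀⁻¹) * (t₀ * (s σ)⁻¹ * t₀⁻¹) := by group
        _ = (s τ * t₀ * (s τ)⁻¹ * t₀⁻¹) * s σ * (t₀ * (s σ)⁻¹ * t₀⁻¹) := by rw [h]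
        _ = (s τ * t₀ * (s τ)⁻¹ * t₀⁻¹) * (s σ * t₀ * (s σ)⁻¹ * t₀⁻¹) := by group
        _ = _ := (h _).symm)
  have hfixab : ∀ σ : Perm α, σ a = a → σ b = b → ∃ σ' : Perm (Subtype p),
      Perm.ofSubtype σ' = σ := by
    intro σ ha hb
    have hp : ∀ x, p (σ x) ↔ p x := by
      intro x
      have h1 : σ x = a ↔ x = a := ⟨fun h => σ.injective (h.trans ha.symm), fun h => h ▸ ha⟩
      have h2 : σ x = b ↔ x = b := ⟨fun h => σ.injective (h.trans hb.symm), fun h => h ▸ hb⟩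
      simp [p, h1, h2]
    refine ⟨σ.subtypePerm hp, Perm.ofSubtype_subtypePerm hp ?_⟩
    intro x hx
    exact ⟨fun h => hx (h ▸ ha), fun h => hx (h ▸ hb)⟩
  have main : ∀ q : Q, π q a = a → π q b = b → q * t₀ = t₀ * q := by
    obtain ⟨g, hg⟩ := hfixab _ ha hb
    have hgs : Perm.sign g = -1 := by rw [← hq₀, ← hg, Perm.sign_ofSubtype]
    have hFg : F g = 1 := by
      change s g * t₀ * (s g)⁻¹ * t₀⁻¹ = 1
      rw [hdep (s g) q₀ (by rw [hs, hg]), hcomm]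
      group
    intro q hqa hqb
    obtain ⟨σ, hσ⟩ := hfixab _ hqa hqb
    have h1 : s σ * t₀ * (s σ)⁻¹ * t₀⁻¹ = 1 := Perm.hom_eq_one_of_sign_eq_neg_one F
      (fun σ τ => (Subgroup.mem_center_iff.1 (hcen σ) (F τ)).symm) hgs hFg σ
    rw [hdep (s σ) q (by rw [hs, hσ])] at h1
    rw [mul_inv_eq_one] at h1
    exact mul_inv_eq_iff_eq_mul.1 h1
  have hqab : swap (π q a) (π q b) = swap a b := by
    rw [swap_apply_apply, hq, mul_inv_cancel_right]
  by_cases hqa : π q a = a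
  · refine main q hqa ?_
    have := congrArg (fun f : Perm α => f a) hqab
    simpa [hqa] using this
  · have h1 : π q a = b := by
      have := congrArg (fun f : Perm α => f (π q a)) hqab
      simp only [swap_apply_left] at this
      by_contra hne
      rw [swap_apply_of_ne_of_ne hqa hne] at this
      exact hab.symm ((π q).injective this)
    have h2 : π q b = a := by
      have := congrArg (fun f : Perm α => f b) hqab
      simpa [h1] using this
    -- A centralizing permutation that interchanges `a` and `b` fixes both after multiplication by
    -- the transposition.
    have := main (t₀ * q) (by simp [ht₀, h1]) (by simp [ht₀, h2])
    rw [mul_assoc] at this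
    exact mul_left_cancel this

/-- In a central extension of a symmetric group with an equivariant lift `x` of the class of an
odd permutation with two fixed points, products of lifts depend only on the number of factors and
on the product. -/
theorem prod_lift_eq {π : Q →* Perm α} (hπ : Function.Surjective π)
    (hker : ∀ k, π k = 1 → ∀ q, k * q = q * k) {C : Set (Perm α)} {x : Perm α → Q}
    (hx : ∀ g ∈ C, π (x g) = g)
    (hxc : ∀ g ∈ C, ∀ q, q * x g * q⁻¹ = x (π q * g * (π q)⁻¹)) {g₀ : Perm α} (hg₀ : g₀ ∈ C)
    (hC : ∀ g ∈ C, IsConj g₀ g) (hodd : Perm.sign g₀ = -1)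
    {a b : α} (hab : a ≠ b) (ha : g₀ a = a) (hb : g₀ b = b) {l₁ l₂ : List (Perm α)}
    (h₁ : ∀ g ∈ l₁, g ∈ C) (h₂ : ∀ g ∈ l₂, g ∈ C) (hlen : l₁.length = l₂.length)
    (hprod : l₁.prod = l₂.prod) : (l₁.map x).prod = (l₂.map x).prod := by
  classical
  obtain ⟨t₀, ht₀⟩ := hπ (swap a b)
  -- By equivariance, conjugation by `t₀` sends `x g₀` to the lift of the conjugate of `g₀`, which
  -- is `g₀` itself because `g₀` fixes `a` and `b`.
  have hcomm₀ : x g₀ * t₀ = t₀ * x g₀ := by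
    have := hxc g₀ hg₀ t₀
    rw [ht₀, swap_mul_eq_mul_swap, Equiv.Perm.inv_eq_iff_eq.2 ha.symm,
      Equiv.Perm.inv_eq_iff_eq.2 hb.symm, mul_inv_cancel_right] at this
    exact (mul_inv_eq_iff_eq_mul.1 this).symm
  have hcen := commute_lift_swap hπ hker hab ht₀ (q₀ := x g₀) (by rw [hx g₀ hg₀, hodd])
    (by rw [hx g₀ hg₀, ha]) (by rw [hx g₀ hg₀, hb]) hcomm₀
  have hwell : ∀ q q' : Q, π q * swap a b * (π q)⁻¹ = π q' * swap a b * (π q')⁻¹ →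
      q * t₀ * q⁻¹ = q' * t₀ * q'⁻¹ := by
    intro q q' h
    have h1 : π (q'⁻¹ * q) * swap a b = swap a b * π (q'⁻¹ * q) := by
      rw [map_mul, map_inv]
      calc (π q')⁻¹ * π q * swap a b = (π q')⁻¹ * (π q * swap a b * (π q)⁻¹) * π q := by group
        _ = _ := by rw [h]; group
    have := hcen _ h1
    calc q * t₀ * q⁻¹ = q' * ((q'⁻¹ * q) * t₀) * q⁻¹ := by group
      _ = q' * (t₀ * (q'⁻¹ * q)) * q⁻¹ := by rw [this]
      _ = _ := by group
  have hlift : ∀ τ : Perm α, τ.IsSwap → ∃ q : Q, π q * swap a b * (π q)⁻¹ = τ := by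
    rintro _ ⟨y, z, hyz, rfl⟩
    obtain ⟨σ, hσ⟩ := isConj_iff.1 (Perm.isConj_swap hab hyz)
    obtain ⟨q, rfl⟩ := hπ σ
    exact ⟨q, hσ⟩
  -- The transposition lift transported by conjugation, independent of the choice by `hwell`. The
  -- value `1` is a default for permutations that are not conjugate to `swap a b`.
  let t : Perm α → Q := fun τ =>
    if h : ∃ q : Q, π q * swap a b * (π q)⁻¹ = τ then h.choose * t₀ * h.choose⁻¹ else 1
  have ht : ∀ q : Q, t (π q * swap a b * (π q)⁻¹) = q * t₀ * q⁻¹ := by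
    intro q
    have h : ∃ q' : Q, π q' * swap a b * (π q')⁻¹ = π q * swap a b * (π q)⁻¹ := ⟨q, rfl⟩
    simp only [t, dif_pos h]
    exact hwell _ _ h.choose_spec
  have htπ : ∀ τ : Perm α, τ.IsSwap → π (t τ) = τ := by
    intro τ hτ
    obtain ⟨q, rfl⟩ := hlift τ hτ
    rw [ht, map_mul, map_mul, map_inv, ht₀]
  have htc : ∀ τ : Perm α, τ.IsSwap → ∀ r : Q, r * t τ * r⁻¹ = t (π r * τ * (π r)⁻¹) := by
    intro τ hτ r
    obtain ⟨q, rfl⟩ := hlift τ hτ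
    have h1 : π r * (π q * swap a b * (π q)⁻¹) * (π r)⁻¹
        = π (r * q) * swap a b * (π (r * q))⁻¹ := by rw [map_mul]; group
    rw [h1, ht, ht]
    group
  have hsys : IsSwapSystem t (t₀ * t₀) := by
    refine ⟨?_, ?_, ?_⟩
    · intro τ τ' hτ hτ'
      have hinv : τ'⁻¹ = τ' := by
        obtain ⟨y, z, -, rfl⟩ := hτ'
        exact swap_inv y z
      have := htc τ hτ (t τ')⁻¹
      rw [map_inv, htπ τ' hτ'] at this
      simp only [inv_inv, hinv] at this
      rw [← this]
      group
    · intro τ hτ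
      obtain ⟨q, rfl⟩ := hlift τ hτ
      rw [ht]
      have := hker (t₀ * t₀) (by rw [map_mul, ht₀, swap_mul_self]) q
      calc q * t₀ * q⁻¹ * (q * t₀ * q⁻¹) = q * (t₀ * t₀) * q⁻¹ := by group
        _ = _ := by rw [← this]; group
    · exact hker (t₀ * t₀) (by rw [map_mul, ht₀, swap_mul_self])
  obtain ⟨L₀, hL₀prod, hL₀⟩ := (Perm.truncSwapFactors g₀).out
  have hπL : ∀ L : List (Perm α), (∀ τ ∈ L, τ.IsSwap) → π (L.map t).prod = L.prod := by
    intro L hL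
    induction L with
    | nil => simp
    | cons τ L ih =>
      simp only [List.forall_mem_cons] at hL
      simp [htπ τ hL.1, ih hL.2]
  have hconjL : ∀ L : List (Perm α), (∀ τ ∈ L, τ.IsSwap) → ∀ q : Q,
      q * (L.map t).prod * q⁻¹ = ((L.map fun τ => π q * τ * (π q)⁻¹).map t).prod := by
    intro L hL q
    induction L with
    | nil => simp
    | cons τ L ih =>
      simp only [List.forall_mem_cons] at hL
      simp only [List.map_cons, List.prod_cons]
      rw [← htc τ hL.1, ← ih hL.2]
      group
  -- The discrepancy between `x g₀` and the lift of a factorization of `g₀` lies in the kernel,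
  -- hence is central. By conjugation the same `z` serves for every element of `C`.
  set z : Q := x g₀ * ((L₀.map t).prod)⁻¹ with hz
  have hzc : ∀ q, z * q = q * z := hker z (by
    rw [hz, map_mul, map_inv, hπL L₀ hL₀, hL₀prod, hx g₀ hg₀, mul_inv_cancel])
  have hfac : ∀ g ∈ C, ∃ L : List (Perm α), (∀ τ ∈ L, τ.IsSwap) ∧ L.length = L₀.length ∧
      L.prod = g ∧ x g = z * (L.map t).prod := by
    intro g hg
    obtain ⟨σ, rfl⟩ := isConj_iff.1 (hC g hg)
    obtain ⟨q, rfl⟩ := hπ σ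
    have hsw : ∀ τ ∈ L₀.map fun τ => π q * τ * (π q)⁻¹, τ.IsSwap := by
      intro τ hτ
      obtain ⟨τ', hτ', rfl⟩ := List.mem_map.1 hτ
      obtain ⟨y, w, hyw, rfl⟩ := hL₀ τ' hτ'
      exact ⟨π q y, π q w, fun h => hyw ((π q).injective h), (swap_apply_apply _ _ _).symm⟩
    have hxg : x (π q * g₀ * (π q)⁻¹) = z * ((L₀.map fun τ => π q * τ * (π q)⁻¹).map t).prod := by
      rw [← hxc g₀ hg₀, ← hconjL L₀ hL₀]
      have : x g₀ = z * (L₀.map t).prod := by rw [hz]; group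
      rw [this, ← mul_assoc, ← hzc q]
      simp only [mul_assoc]
    refine ⟨_, hsw, by simp, ?_, hxg⟩
    rw [← hπL _ hsw]
    have h3 : π z = 1 := by
      rw [hz, map_mul, map_inv, hπL L₀ hL₀, hL₀prod, hx g₀ hg₀, mul_inv_cancel]
    have := congrArg π hxg
    rw [hx _ hg, map_mul, h3, one_mul] at this
    exact this.symm
  have hword : ∀ l : List (Perm α), (∀ g ∈ l, g ∈ C) → ∃ L : List (Perm α),
      (∀ τ ∈ L, τ.IsSwap) ∧ L.length = l.length * L₀.length ∧ L.prod = l.prod ∧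
      (l.map x).prod = z ^ l.length * (L.map t).prod := by
    intro l hl
    induction l with
    | nil => exact ⟨[], by simp⟩
    | cons g l ih =>
      simp only [List.forall_mem_cons] at hl
      obtain ⟨L, hL, hlen, hprod, heq⟩ := ih hl.2
      obtain ⟨L', hL', hlen', hprod', heq'⟩ := hfac g hl.1
      refine ⟨L' ++ L, ?_, ?_, ?_, ?_⟩
      · intro τ hτ
        exact (List.mem_append.1 hτ).elim (hL' τ) (hL τ)
      · simp [hlen, hlen']; ring
      · simp [hprod, hprod']
      · have hzp : ∀ q, z ^ l.length * q = q * z ^ l.length := fun q =>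
          (Commute.pow_left (hzc q) _)
        simp only [List.map_cons, List.prod_cons, heq, heq', List.map_append, List.prod_append,
          List.length_cons, pow_succ']
        rw [mul_assoc, ← mul_assoc (List.map t L').prod, ← hzp]
        simp only [mul_assoc]
  obtain ⟨L₁, hL₁, hlen₁, hprod₁, heq₁⟩ := hword l₁ h₁
  obtain ⟨L₂, hL₂, hlen₂, hprod₂, heq₂⟩ := hword l₂ h₂
  rw [heq₁, heq₂, hlen, hsys.prod_eq hL₁ hL₂ (by rw [hprod₁, hprod₂, hprod])
    (by rw [hlen₁, hlen₂, hlen])]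

end CentralExtension

/-! ### The universal monoid of a set of conjugates -/

/-- The relations `x_g x_h = x_h x_{h⁻¹ g h}`. -/
inductive BraidRel {G : Type*} [Group G] (C : Finset G) :
    FreeMonoid {g // g ∈ C} → FreeMonoid {g // g ∈ C} → Prop
  | swap (g h k : {g // g ∈ C}) (hk : k.1 = h.1⁻¹ * g.1 * h.1) :
      BraidRel C (FreeMonoid.of g * FreeMonoid.of h) (FreeMonoid.of h * FreeMonoid.of k)

/-- The monoid generated by `x_g`, `g ∈ C`, with the relations `x_g x_h = x_h x_{h⁻¹ g h}`. -/
abbrev BraidMonoid {G : Type*} [Group G] (C : Finset G) : Type _ := PresentedMonoid (BraidRel C)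

theorem PresentedMonoid.induction_left {α : Type*} {rels : FreeMonoid α → FreeMonoid α → Prop}
    {p : PresentedMonoid rels → Prop} (one : p 1)
    (mul : ∀ x m, p m → p (PresentedMonoid.of rels x * m)) (m : PresentedMonoid rels) : p m := by
  induction m using PresentedMonoid.inductionOn with
  | h w =>
    induction w using FreeMonoid.inductionOn' with
    | one => simpa using one
    | of_mul x w ih => rw [map_mul]; exact mul x _ ih

namespace BraidMonoid

variable {G : Type*} [Group G] {C : Finset G}

/-- The product homomorphism. -/
def prod (C : Finset G) : BraidMonoid C →* G :=
  PresentedMonoid.lift Subtype.val (by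
    rintro _ _ ⟨g, h, k, hk⟩
    simp [hk, mul_assoc])

/-- The number of letters. -/
def degree (C : Finset G) : BraidMonoid C →* Multiplicative ℕ :=
  PresentedMonoid.lift (fun _ => Multiplicative.ofAdd 1) (by
    rintro _ _ ⟨g, h, k, hk⟩
    simp)

/-- The action on subgroups by which a letter adds its index to the generators. -/
def genAct (C : Finset G) : BraidMonoid C →* Function.End (Subgroup G) :=
  PresentedMonoid.lift (M := Function.End (Subgroup G)) (fun g S => Subgroup.zpowers g.1 ⊔ S) (by
    rintro _ _ ⟨g, h, k, hk⟩
    simp only [map_mul]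
    funext S
    change Subgroup.zpowers g.1 ⊔ (Subgroup.zpowers h.1 ⊔ S) =
      Subgroup.zpowers h.1 ⊔ (Subgroup.zpowers k.1 ⊔ S)
    have hh : ∀ A : Subgroup G, h.1 ∈ Subgroup.zpowers h.1 ⊔ A := fun A =>
      (le_sup_left : _ ≤ Subgroup.zpowers h.1 ⊔ A) (Subgroup.mem_zpowers _)
    apply le_antisymm
    · refine sup_le ?_ (sup_le le_sup_left (le_sup_right.trans le_sup_right))
      rw [Subgroup.zpowers_le]
      set A := Subgroup.zpowers h.1 ⊔ (Subgroup.zpowers k.1 ⊔ S)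
      have hkA : k.1 ∈ A := (le_sup_left.trans le_sup_right : Subgroup.zpowers k.1 ≤ A)
        (Subgroup.mem_zpowers _)
      have := A.mul_mem (A.mul_mem (hh _) hkA) (A.inv_mem (hh _))
      rw [hk] at this
      simpa [mul_assoc] using this
    · refine sup_le (le_sup_left.trans le_sup_right)
        (sup_le ?_ (le_sup_right.trans le_sup_right))
      rw [Subgroup.zpowers_le, hk]
      set A := Subgroup.zpowers g.1 ⊔ (Subgroup.zpowers h.1 ⊔ S)
      have hhA : h.1 ∈ A := (le_sup_right : _ ≤ A) (hh _)
      have hgA : g.1 ∈ A := (le_sup_left : _ ≤ A) (Subgroup.mem_zpowers _)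
      exact A.mul_mem (A.mul_mem (A.inv_mem hhA) hgA) hhA)

/-- The action of `m` is the join with its value at `⊥`; this makes that value a multiplicative
generated subgroup. -/
theorem genAct_eq (m : BraidMonoid C) (S : Subgroup G) :
    genAct C m S = genAct C m ⊥ ⊔ S := by
  induction m using PresentedMonoid.induction_left with
  | one => rw [map_one]; change S = ⊥ ⊔ S; simp
  | mul x m ih =>
    rw [map_mul]
    change Subgroup.zpowers x.1 ⊔ genAct C m S = Subgroup.zpowers x.1 ⊔ genAct C m ⊥ ⊔ S
    rw [ih, sup_assoc]

open Classical in
/-- The generator `x_g`, and `1` if `g ∉ C`. -/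
noncomputable def X (C : Finset G) (g : G) : BraidMonoid C :=
  if h : g ∈ C then PresentedMonoid.of _ ⟨g, h⟩ else 1

theorem X_of_mem {g : G} (hg : g ∈ C) : X C g = PresentedMonoid.of _ ⟨g, hg⟩ := dif_pos hg

theorem of_eq_X (x : {g // g ∈ C}) : PresentedMonoid.of (BraidRel C) x = X C x.1 :=
  (X_of_mem x.2).symm

theorem prod_X {g : G} (hg : g ∈ C) : prod C (X C g) = g := by
  rw [X_of_mem hg]; rfl

theorem degree_X {g : G} (hg : g ∈ C) : degree C (X C g) = Multiplicative.ofAdd 1 := by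
  rw [X_of_mem hg]; rfl

theorem X_mul_X {g h : G} (hC : ∀ g ∈ C, ∀ c : G, c * g * c⁻¹ ∈ C) (hg : g ∈ C) (hh : h ∈ C) :
    X C h * X C g = X C (h * g * h⁻¹) * X C h := by
  rw [X_of_mem hg, X_of_mem hh, X_of_mem (hC g hg h)]
  symm
  exact PresentedMonoid.mk_eq_mk_of_rel (.swap ⟨h * g * h⁻¹, hC g hg h⟩ ⟨h, hh⟩ ⟨g, hg⟩ (by group))

theorem mul_X (hC : ∀ g ∈ C, ∀ c : G, c * g * c⁻¹ ∈ C) (m : BraidMonoid C) :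
    ∀ g ∈ C, m * X C g = X C (prod C m * g * (prod C m)⁻¹) * m := by
  induction m using PresentedMonoid.induction_left with
  | one => intro g _; simp
  | mul x m ih =>
    intro g hg
    rw [of_eq_X, mul_assoc, ih g hg, ← mul_assoc, X_mul_X hC (hC g hg _) x.2, mul_assoc, map_mul,
      prod_X x.2]
    congr 2
    group

/-- A letter passing `u` is conjugated by the product of `u`, that is, not changed at all. In the
quotient this makes the kernel of the product map central. -/
theorem commute_of_prod_eq_one (hC : ∀ g ∈ C, ∀ c : G, c * g * c⁻¹ ∈ C) {u : BraidMonoid C}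
    (hu : prod C u = 1) (m : BraidMonoid C) : Commute u m := by
  induction m using PresentedMonoid.induction_left with
  | one => exact Commute.one_right u
  | mul x m ih =>
    refine Commute.mul_right ?_ ih
    have := mul_X hC u x.1 x.2
    rw [hu] at this
    rw [of_eq_X, commute_iff_eq]
    simpa using this

/-- The braid system of the universal monoid. -/
noncomputable def system (hC : ∀ g ∈ C, ∀ c : G, c * g * c⁻¹ ∈ C) :
    BraidSystem (C : Set G) (BraidMonoid C) :=
  let B : PreBraidSystem (C : Set G) (BraidMonoid C) :=
    { prod := prod C
      X := X C
      gen := fun m => genAct C m ⊥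
      conj_mem := hC
      prod_X := fun g hg => prod_X hg
      gen_X := fun g hg => by
        rw [X_of_mem hg]
        change Subgroup.zpowers g ⊔ ⊥ = _
        simp
      gen_mul := fun m m' => by
        rw [map_mul]
        exact genAct_eq m _
      mul_X := fun g hg m => mul_X hC m g hg
      commute_pow := fun g hg k hk m =>
        commute_of_prod_eq_one hC (by rw [map_pow, prod_X hg, hk]) m }
  { B with
    -- Each single letter `X x` has product `x`, so `prod_mem_stab` applied letter by letter
    -- suffices here.
    gen_le_stab := fun m => by
      induction m using PresentedMonoid.induction_left with
      | one =>
        change genAct C 1 ⊥ ≤ _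
        rw [map_one]
        exact bot_le
      | mul x m ih =>
        change B.gen (_ * m) ≤ B.stab _
        rw [B.gen_mul]
        refine sup_le ?_ (ih.trans (B.stab_le_stab_mul_left _ _))
        refine le_trans ?_ (B.stab_le_stab_mul_right _ _)
        rw [of_eq_X, show X C x.1 = B.X x.1 from rfl, B.gen_X _ x.2, Subgroup.zpowers_le]
        have := B.prod_mem_stab (B.X x.1)
        rwa [B.prod_X _ x.2] at this }

theorem degree_listX (hC : ∀ g ∈ C, ∀ c : G, c * g * c⁻¹ ∈ C) {l : List G} (hl : ∀ g ∈ l, g ∈ C) :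
    degree C ((system hC).listX l) = Multiplicative.ofAdd l.length := by
  induction l with
  | nil => simp
  | cons g l ih =>
    simp only [List.forall_mem_cons] at hl
    rw [BraidSystem.listX_cons, map_mul, ih hl.2, show (system hC).X g = X C g from rfl,
      degree_X hl.1, ← ofAdd_add, List.length_cons, add_comm]

section Quotient

variable {N : ℕ} (hG : BraidSystem.Good (C : Set G) C N)

/-- The congruence that makes the central element `W` trivial. -/
def killW (hG : BraidSystem.Good (C : Set G) C N) : Con (BraidMonoid C) where
  r u v := ∃ i j : ℕ, (system hG.conj_mem).W C N ^ i * u = (system hG.conj_mem).W C N ^ j * v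
  iseqv := by
    refine ⟨fun u => ⟨0, 0, rfl⟩, ?_, ?_⟩
    · rintro u v ⟨i, j, h⟩
      exact ⟨j, i, h.symm⟩
    · rintro u v w ⟨i, j, h⟩ ⟨i', j', h'⟩
      refine ⟨i' + i, j + j', ?_⟩
      rw [pow_add, mul_assoc, h, ← mul_assoc, ← pow_add, add_comm, pow_add, mul_assoc, h',
        ← mul_assoc, ← pow_add]
  mul' := by
    rintro u v u' v' ⟨i, j, h⟩ ⟨i', j', h'⟩
    have hc := fun k => ((system hG.conj_mem).commute_W (C := C) hG.pow_eq_one hG.subset k)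
    refine ⟨i + i', j + j', ?_⟩
    calc (system hG.conj_mem).W C N ^ (i + i') * (u * u')
        = ((system hG.conj_mem).W C N ^ i * u) * ((system hG.conj_mem).W C N ^ i' * u') := by
          rw [pow_add, mul_assoc, ← mul_assoc _ u, ((hc u).pow_left i').eq]
          simp only [mul_assoc]
      _ = ((system hG.conj_mem).W C N ^ j * v) * ((system hG.conj_mem).W C N ^ j' * v') := by
          rw [h, h']
      _ = _ := by
          rw [pow_add, mul_assoc _ _ (v * v'), ← mul_assoc _ v, ((hc v).pow_left j').eq]
          simp only [mul_assoc]

theorem coe_W : (((system hG.conj_mem).W C N : BraidMonoid C) : (killW hG).Quotient) = 1 :=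
  (killW hG).eq.2 ⟨0, 1, by simp⟩

/-- Every generator is both a left and a right factor of `W`, which has become `1`. -/
theorem isUnit_quotient (q : (killW hG).Quotient) : IsUnit q := by
  induction q using Con.induction_on with
  | H m =>
    induction m using PresentedMonoid.induction_left with
    | one => exact isUnit_one
    | mul x m ih =>
      rw [Con.coe_mul]
      refine IsUnit.mul ?_ ih
      obtain ⟨l, -, -, h⟩ := (system hG.conj_mem).exists_W_eq_X_mul hG.conj_mem hG.subset
        hG.ne_zero x.2
      obtain ⟨l', -, -, h'⟩ := (system hG.conj_mem).exists_W_eq_mul_X hG.conj_mem hG.subset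
        hG.pow_eq_one hG.ne_zero x.2
      have e := coe_W hG
      have e' := coe_W hG
      rw [h, Con.coe_mul] at e
      rw [h', Con.coe_mul] at e'
      rw [of_eq_X]
      have := left_inv_eq_right_inv e' e
      rw [this] at e'
      exact ⟨⟨_, _, e, e'⟩, rfl⟩

noncomputable instance : Group (killW hG).Quotient := groupOfIsUnit (isUnit_quotient hG)

/-- The product homomorphism on the quotient. -/
noncomputable def prodQuotient : (killW hG).Quotient →* G :=
  (killW hG).lift (prod C) (by
    rintro u v ⟨i, j, h⟩
    have hW : prod C ((system hG.conj_mem).W C N) = 1 :=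
      (system hG.conj_mem).prod_W hG.pow_eq_one hG.subset
    have := congrArg (prod C) h
    simpa [hW] using this)

theorem prodQuotient_coe (u : BraidMonoid C) : prodQuotient hG u = prod C u := rfl

theorem prodQuotient_surjective : Function.Surjective (prodQuotient hG) := by
  intro g
  refine hG.induction (p := fun g => ∃ q, prodQuotient hG q = g) ⟨1, map_one _⟩ ?_ ?_ g
  · intro g hg
    exact ⟨(X C g : BraidMonoid C), prod_X hg⟩
  · rintro _ _ ⟨q, rfl⟩ ⟨q', rfl⟩
    exact ⟨q * q', map_mul _ _ _⟩

theorem prodQuotient_ker (k : (killW hG).Quotient) (hk : prodQuotient hG k = 1)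
    (q : (killW hG).Quotient) : k * q = q * k := by
  induction k using Con.induction_on with
  | H u =>
    induction q using Con.induction_on with
    | H v =>
      rw [← Con.coe_mul, ← Con.coe_mul, (commute_of_prod_eq_one hG.conj_mem hk v).eq]

theorem conj_quotient {g : G} (hg : g ∈ C) (q : (killW hG).Quotient) :
    q * (X C g : BraidMonoid C) * q⁻¹
      = (X C (prodQuotient hG q * g * (prodQuotient hG q)⁻¹) : BraidMonoid C) := by
  induction q using Con.induction_on with
  | H u =>
    rw [mul_inv_eq_iff_eq_mul, ← Con.coe_mul, mul_X hG.conj_mem u g hg, Con.coe_mul,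
      prodQuotient_coe]

end Quotient

end BraidMonoid

/-! ### Long words in an odd class with two fixed points -/

open BraidSystem in
/-- Every long list becomes short at the cost of a power of one letter. -/
theorem BraidSystem.exists_listX_eq_mul_pow {G : Type*} [Group G] {O : Set G} {M : Type*}
    [Monoid M] (B : BraidSystem O M) {C : Finset G} {N : ℕ} (hG : Good O C N) {g₀ : G}
    (hg₀ : g₀ ∈ C) (j : ℕ) : ∀ (L : List G) (m : M), (∀ g ∈ L, g ∈ C) →
      L.length = bound C N 1 + j → B.gen (B.listX L * m) = ⊤ →
      ∃ r : List G, (∀ g ∈ r, g ∈ C) ∧ r.length = bound C N 1 ∧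
        B.listX L * m = B.listX r * B.X g₀ ^ j * m := by
  induction j with
  | zero => intro L m hL hlen _; exact ⟨L, hL, by simpa using hlen, by simp⟩
  | succ j ih =>
    intro L m hL hlen htop
    obtain ⟨L', h, rfl⟩ : ∃ L' h, L = L' ++ [h] := by
      have : L ≠ [] := by rintro rfl; simp at hlen
      exact ⟨_, _, (List.dropLast_append_getLast this).symm⟩
    have hL' : ∀ g ∈ L', g ∈ C := fun g hg => hL g (by simp [hg])
    have hh : h ∈ C := hL h (by simp)
    have hlen' : L'.length = bound C N 1 + j := by simp at hlen; omega
    rw [listX_append] at htop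
    -- The last letter becomes `g₀` at the expense of the preceding ones, of which there are still
    -- enough; `X g₀ * m` is the tail for the next round.
    obtain ⟨l', hl', hll, heq⟩ := Replace.of_isConj hG (hG.subset h hh) (hG.isConj h hh g₀ hg₀) L' m
      hL' (by omega) htop
    obtain ⟨r, hr, hrl, heq'⟩ := ih l' (B.X g₀ * m) hl' (hll.trans hlen') (by
      rw [← htop, heq]; simp [mul_assoc])
    refine ⟨r, hr, hrl, ?_⟩
    rw [listX_append, heq]
    simp only [listX_cons, listX_nil, mul_one, mul_assoc] at heq' ⊢
    rw [heq', pow_succ]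
    simp only [mul_assoc]

namespace BraidMonoid

open Equiv BraidSystem

variable {α : Type*} [Fintype α] [DecidableEq α] {C : Finset (Perm α)} {N : ℕ}

/-- The words have equal images in the central extension by `prod_lift_eq`, so they agree up to two
powers of `W`. Counting letters shows that the two exponents coincide. -/
theorem exists_W_pow_mul_eq (hG : Good (C : Set (Perm α)) C N) {g₀ : Perm α} (hg₀ : g₀ ∈ C)
    (hodd : Perm.sign g₀ = -1) {a b : α} (hab : a ≠ b) (ha : g₀ a = a) (hb : g₀ b = b)
    {l₁ l₂ : List (Perm α)} (h₁ : ∀ g ∈ l₁, g ∈ C) (h₂ : ∀ g ∈ l₂, g ∈ C)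
    (hlen : l₁.length = l₂.length) (hprod : l₁.prod = l₂.prod) :
    ∃ i : ℕ, (system hG.conj_mem).W C N ^ i * (system hG.conj_mem).listX l₁
      = (system hG.conj_mem).W C N ^ i * (system hG.conj_mem).listX l₂ := by
  have key := prod_lift_eq (π := prodQuotient hG) (prodQuotient_surjective hG)
    (prodQuotient_ker hG) (C := (C : Set (Perm α)))
    (x := fun g => ((X C g : BraidMonoid C) : (killW hG).Quotient))
    (fun g hg => prod_X hg) (fun g hg q => conj_quotient hG hg q) hg₀ (fun g hg =>
      hG.isConj g₀ hg₀ g hg) hodd hab ha hb h₁ h₂ hlen hprod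
  have hcoe : ∀ l : List (Perm α), (((system hG.conj_mem).listX l : BraidMonoid C) :
      (killW hG).Quotient) = (l.map fun g => ((X C g : BraidMonoid C) :
        (killW hG).Quotient)).prod := by
    intro l
    induction l with
    | nil => rfl
    | cons g l ih => rw [listX_cons, Con.coe_mul, ih, List.map_cons, List.prod_cons]; rfl
  rw [← hcoe, ← hcoe] at key
  obtain ⟨i, j, hij⟩ := (killW hG).eq.1 key
  have hdeg := congrArg (degree C) hij
  have hpos : 0 < (wList C N).length :=
    List.length_pos_iff_exists_mem.2 ⟨g₀, (mem_wList hG.ne_zero).2 hg₀⟩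
  rw [map_mul, map_mul, map_pow, map_pow, degree_listX hG.conj_mem h₁,
    degree_listX hG.conj_mem h₂, hlen, W, degree_listX hG.conj_mem fun g hg => mem_of_mem_wList hg,
    mul_left_inj, ← ofAdd_nsmul, ← ofAdd_nsmul] at hdeg
  have hij' : i = j := by
    have h := Multiplicative.ofAdd.injective hdeg
    exact Nat.eq_of_mul_eq_mul_right hpos (by simpa using h)
  subst hij'
  exact ⟨i, hij⟩

/-- Long generating words in the letters of an odd class with two fixed points are determined by
their length and their product. -/
theorem exists_forall_listX_eq (hG : Good (C : Set (Perm α)) C N) {g₀ : Perm α} (hg₀ : g₀ ∈ C)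
    (hodd : Perm.sign g₀ = -1) {a b : α} (hab : a ≠ b) (ha : g₀ a = a) (hb : g₀ b = b) :
    ∃ T : ℕ, ∀ l₁ l₂ : List (Perm α), (∀ g ∈ l₁, g ∈ C) → (∀ g ∈ l₂, g ∈ C) →
      T ≤ l₁.length → l₁.length = l₂.length → l₁.prod = l₂.prod →
      (system hG.conj_mem).gen ((system hG.conj_mem).listX l₁) = ⊤ →
      (system hG.conj_mem).gen ((system hG.conj_mem).listX l₂) = ⊤ →
      (system hG.conj_mem).listX l₁ = (system hG.conj_mem).listX l₂ := by
  classical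
  set B := system hG.conj_mem with hB
  set M := bound C N 1 with hM
  -- There are finitely many pairs of lists of length `M`, so one exponent serves for all of them.
  obtain ⟨K, hK⟩ : ∃ K : ℕ, ∀ r₁ r₂ : List (Perm α), r₁.length = M → r₂.length = M →
      (∀ g ∈ r₁, g ∈ C) → (∀ g ∈ r₂, g ∈ C) → r₁.prod = r₂.prod →
      B.W C N ^ K * B.listX r₁ = B.W C N ^ K * B.listX r₂ := by
    have hfin : {l : List (Perm α) | l.length = M}.Finite := List.finite_length_eq _ _
    have hex : ∀ r : List (Perm α) × List (Perm α), ∃ i : ℕ, r.1.length = M → r.2.length = M →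
      (∀ g ∈ r.1, g ∈ C) → (∀ g ∈ r.2, g ∈ C) → r.1.prod = r.2.prod →
      B.W C N ^ i * B.listX r.1 = B.W C N ^ i * B.listX r.2 := by
      rintro ⟨r₁, r₂⟩
      by_cases h : r₁.length = M ∧ r₂.length = M ∧ (∀ g ∈ r₁, g ∈ C) ∧ (∀ g ∈ r₂, g ∈ C) ∧
        r₁.prod = r₂.prod
      · obtain ⟨h1, h2, h3, h4, h5⟩ := h
        obtain ⟨i, hi⟩ := exists_W_pow_mul_eq hG hg₀ hodd hab ha hb h3 h4 (h1.trans h2.symm) h5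
        exact ⟨i, fun _ _ _ _ _ => hi⟩
      · exact ⟨0, fun h1 h2 h3 h4 h5 => absurd ⟨h1, h2, h3, h4, h5⟩ h⟩
    choose f hf using hex
    refine ⟨(hfin.prod hfin).toFinset.sup f, fun r₁ r₂ h1 h2 h3 h4 h5 => ?_⟩
    have hle : f (r₁, r₂) ≤ (hfin.prod hfin).toFinset.sup f :=
      Finset.le_sup (by simp [h1, h2])
    obtain ⟨k, hk⟩ := Nat.exists_eq_add_of_le hle
    rw [hk, add_comm, pow_add, mul_assoc, mul_assoc, hf (r₁, r₂) h1 h2 h3 h4 h5]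
  refine ⟨max (bound C N (K + 1)) (K * (wList C N).length + M), ?_⟩
  have red : ∀ l : List (Perm α), (∀ g ∈ l, g ∈ C) →
      max (bound C N (K + 1)) (K * (wList C N).length + M) ≤ l.length → B.gen (B.listX l) = ⊤ →
      ∃ r : List (Perm α), (∀ g ∈ r, g ∈ C) ∧ r.length = M ∧
        B.listX l = B.W C N ^ K * B.listX r *
          B.X g₀ ^ (l.length - (K * (wList C N).length + M)) := by
    intro l hl hT htop
    obtain ⟨l', hl', hlen', heq⟩ := B.regenerate hG.conj_mem hG.subset hG.isConj hG.nonempty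
      hG.pow_eq_one hG.ne_zero (K + 1) l hl ((le_max_left _ _).trans hT) 1 (by simpa using htop)
    have hT' := (le_max_right _ _).trans hT
    -- Of the `K + 1` copies of `W`, one is spelled out as letters: it makes the rest generate on
    -- its own, so that it can be shortened while `W ^ K` is kept aside.
    have hL : ∀ g ∈ wList C N ++ l', g ∈ C := fun g hg =>
      (List.mem_append.1 hg).elim mem_of_mem_wList (hl' g)
    have hLlen : (wList C N ++ l').length = M + (l.length - (K * (wList C N).length + M)) := by
      rw [List.length_append]
      rw [add_mul] at hlen'
      omega
    obtain ⟨r, hr, hrlen, hreq⟩ := B.exists_listX_eq_mul_pow hG hg₀ _ (wList C N ++ l') 1 hL hLlen (by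
      rw [mul_one, listX_append]
      exact B.gen_W_mul hG _)
    refine ⟨r, hr, hrlen, ?_⟩
    rw [mul_one, mul_one] at hreq heq
    rw [heq, mul_assoc, ← hreq, listX_append, pow_succ]
    simp only [mul_assoc]
    rfl
  intro l₁ l₂ h₁ h₂ hT hlen hprod htop₁ htop₂
  obtain ⟨r₁, hr₁, hrl₁, heq₁⟩ := red l₁ h₁ hT htop₁
  obtain ⟨r₂, hr₂, hrl₂, heq₂⟩ := red l₂ h₂ (hlen ▸ hT) htop₂
  have hp : r₁.prod = r₂.prod := by
    have e₁ := B.prod_listX h₁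
    have e₂ := B.prod_listX h₂
    rw [heq₁, map_mul, map_mul, map_pow, B.prod_W hG.pow_eq_one hG.subset, B.prod_listX hr₁] at e₁
    rw [heq₂, map_mul, map_mul, map_pow, B.prod_W hG.pow_eq_one hG.subset, B.prod_listX hr₂,
      ← hprod, ← e₁, hlen] at e₂
    exact (mul_left_cancel (mul_right_cancel e₂)).symm
  rw [heq₁, heq₂, hK r₁ r₂ hrl₁ hrl₂ hr₁ hr₂ hp, hlen]

end BraidMonoid

/-! ### Explicit braid automorphisms of small frames -/

namespace FrameGroup

theorem hom_ext {n p : ℕ} {G : Type*} [Group G] {f f' : FrameGroup n p →* G}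
    (hg : ∀ i, f (gam i) = f' (gam i)) (hl : ∀ j, f (lam j) = f' (lam j))
    (hm : ∀ j, f (mu j) = f' (mu j)) : f = f' := by
  apply FreeGroup.ext_hom
  rintro (i | j | j)
  · exact hg i
  · exact hl j
  · exact hm j

/-- The homomorphism with given values at the generators. -/
def ofValues {n p : ℕ} {G : Type*} [Group G] (g : Fin n → G) (a b : Fin p → G) :
    FrameGroup n p →* G :=
  FreeGroup.lift (Sum.elim g (Sum.elim a b))

section

variable {n p : ℕ} {G : Type*} [Group G] (g : Fin n → G) (a b : Fin p → G)

@[simp] theorem ofValues_gam (i : Fin n) : ofValues g a b (gam i) = g i := by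
  simp [ofValues, gam]

@[simp] theorem ofValues_lam (j : Fin p) : ofValues g a b (lam j) = a j := by
  simp [ofValues, lam]

@[simp] theorem ofValues_mu (j : Fin p) : ofValues g a b (mu j) = b j := by
  simp [ofValues, mu]

end

/-- The automorphism with given mutually inverse values at the generators. -/
def autOfValues {n p : ℕ} (g : Fin n → FrameGroup n p) (a b : Fin p → FrameGroup n p)
    (g' : Fin n → FrameGroup n p) (a' b' : Fin p → FrameGroup n p)
    (h : (ofValues g' a' b').comp (ofValues g a b) = MonoidHom.id _)
    (h' : (ofValues g a b).comp (ofValues g' a' b') = MonoidHom.id _) :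
    MulAut (FrameGroup n p) :=
  MonoidHom.toMulEquiv (ofValues g a b) (ofValues g' a' b') h h'

/-- The half-twist of two generators. -/
def sigmaAut : MulAut (FrameGroup 2 0) :=
  autOfValues ![gam 1, (gam 1)⁻¹ * gam 0 * gam 1] Fin.elim0 Fin.elim0
    ![gam 0 * gam 1 * (gam 0)⁻¹, gam 0] Fin.elim0 Fin.elim0
    (hom_ext (fun i => by fin_cases i <;> simp [mul_assoc]) (fun j => j.elim0) (fun j => j.elim0))
    (hom_ext (fun i => by fin_cases i <;> simp [mul_assoc]) (fun j => j.elim0) (fun j => j.elim0))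

theorem isSigma_sigmaAut : IsSigma 0 1 sigmaAut where
  next := rfl
  map_i := by simp [sigmaAut, autOfValues]
  map_i' := by simp [sigmaAut, autOfValues]
  map_gam j h0 h1 := by fin_cases j <;> simp_all
  map_lam j := j.elim0
  map_mu j := j.elim0

theorem moved_zero {n p : ℕ} (l : Fin n) : (moved l 0 : FrameGroup n p) = gam l := by
  simp [moved, commProd]

theorem moved_one (l : Fin 1) :
    (moved l 1 : FrameGroup 1 1) = ⁅(lam 0 : FrameGroup 1 1), mu 0⁆⁻¹ * gam 0 *
      ⁅(lam 0 : FrameGroup 1 1), mu 0⁆ := by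
  rw [Subsingleton.elim l 0]
  simp [moved, commProd]

/-- `ξ_{1,λ}` on one puncture and one handle. -/
def xiLamAut : MulAut (FrameGroup 1 1) :=
  autOfValues
    (fun _ => (lam 0 * (mu 0)⁻¹ * (lam 0)⁻¹ * (gam 0)⁻¹)⁻¹ * gam 0 *
      (lam 0 * (mu 0)⁻¹ * (lam 0)⁻¹ * (gam 0)⁻¹))
    (fun _ => gam 0 * lam 0) (fun _ => mu 0)
    (fun _ => lam 0 * (mu 0)⁻¹ * (lam 0)⁻¹ * gam 0 * (lam 0 * mu 0 * (lam 0)⁻¹))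
    (fun _ => lam 0 * (mu 0)⁻¹ * (lam 0)⁻¹ * (gam 0)⁻¹ * (lam 0 * mu 0)) (fun _ => mu 0)
    (hom_ext (fun i => by rw [Subsingleton.elim i 0]; simp; group)
      (fun i => by rw [Subsingleton.elim i 0]; simp; group)
      (fun i => by rw [Subsingleton.elim i 0]; simp))
    (hom_ext (fun i => by rw [Subsingleton.elim i 0]; simp; group)
      (fun i => by rw [Subsingleton.elim i 0]; simp; group)
      (fun i => by rw [Subsingleton.elim i 0]; simp))

theorem isXiLam_xiLamAut : IsXiLam 0 0 xiLamAut where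
  last := rfl
  map_moved := by simp [moved_zero, xiLamAut, autOfValues]
  map_lam_self := by simp [moved_zero, xiLamAut, autOfValues]
  map_gam j h := absurd (Subsingleton.elim j 0) h
  map_lam j h := absurd (Subsingleton.elim j 0) h
  map_mu j := by rw [Subsingleton.elim j 0]; simp [xiLamAut, autOfValues]

/-- `ξ_{1,μ}` on one puncture and one handle. -/
def xiMuAut : MulAut (FrameGroup 1 1) :=
  autOfValues
    -- `IsXiMu` prescribes the image of the moved generator; solved for `gam 0`, the image is the
    -- moved generator conjugated by `lam 0`.
    (fun _ => lam 0 * (⁅(lam 0 : FrameGroup 1 1), mu 0⁆⁻¹ * gam 0 *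
      ⁅(lam 0 : FrameGroup 1 1), mu 0⁆) * (lam 0)⁻¹)
    (fun _ => lam 0)
    (fun _ => (⁅(lam 0 : FrameGroup 1 1), mu 0⁆⁻¹ * gam 0 * ⁅(lam 0 : FrameGroup 1 1), mu 0⁆)⁻¹ *
      mu 0)
    (fun _ => gam 0 * lam 0 * (mu 0 * (lam 0)⁻¹ * (mu 0)⁻¹) * (lam 0)⁻¹ * gam 0 * lam 0 *
      (mu 0 * lam 0 * (mu 0)⁻¹) * (lam 0)⁻¹ * (gam 0)⁻¹)
    (fun _ => lam 0) (fun _ => (lam 0)⁻¹ * gam 0 * lam 0 * mu 0)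
    (hom_ext (fun i => by rw [Subsingleton.elim i 0]; simp [commutatorElement_def]; group)
      (fun i => by rw [Subsingleton.elim i 0]; simp)
      (fun i => by rw [Subsingleton.elim i 0]; simp [commutatorElement_def]; group))
    (hom_ext (fun i => by rw [Subsingleton.elim i 0]; simp [commutatorElement_def]; group)
      (fun i => by rw [Subsingleton.elim i 0]; simp)
      (fun i => by rw [Subsingleton.elim i 0]; simp [commutatorElement_def]; group))

theorem isXiMu_xiMuAut : IsXiMu 0 0 xiMuAut where
  last := rfl
  map_moved := by
    simp [moved_one, xiMuAut, autOfValues, commutatorElement_def]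
    group
  map_mu_self := by simp [moved_one, xiMuAut, autOfValues]
  map_gam j h := absurd (Subsingleton.elim j 0) h
  map_lam j := by rw [Subsingleton.elim j 0]; simp [xiMuAut, autOfValues]
  map_mu j h := absurd (Subsingleton.elim j 0) h

/-- `ζ_1` on one puncture and one handle. -/
def zetaAut : MulAut (FrameGroup 1 1) :=
  autOfValues (fun _ => zetaConj 0 0)
    (fun _ => (zetaConj 0 0)⁻¹ * lam 0 * zetaConj 0 0)
    (fun _ => (zetaConj 0 0)⁻¹ * mu 0 * zetaConj 0 0)
    (fun _ => gam 0 * ⁅(lam 0 : FrameGroup 1 1), mu 0⁆ * gam 0 *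
      ⁅(lam 0 : FrameGroup 1 1), mu 0⁆⁻¹ * (gam 0)⁻¹)
    (fun _ => gam 0 * lam 0 * (gam 0)⁻¹) (fun _ => gam 0 * mu 0 * (gam 0)⁻¹)
    (hom_ext
      (fun i => by
        rw [Subsingleton.elim i 0]; simp [zetaConj, moved_zero, commutatorElement_def]; group)
      (fun i => by
        rw [Subsingleton.elim i 0]; simp [zetaConj, moved_zero, commutatorElement_def]; group)
      (fun i => by
        rw [Subsingleton.elim i 0]; simp [zetaConj, moved_zero, commutatorElement_def]; group))
    (hom_ext
      (fun i => by
        rw [Subsingleton.elim i 0]; simp [zetaConj, moved_zero, commutatorElement_def]; group)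
      (fun i => by
        rw [Subsingleton.elim i 0]; simp [zetaConj, moved_zero, commutatorElement_def]; group)
      (fun i => by
        rw [Subsingleton.elim i 0]; simp [zetaConj, moved_zero, commutatorElement_def]; group))

theorem isZeta_zetaAut : IsZeta 0 0 zetaAut where
  last := rfl
  map_moved := by simp [moved_zero, zetaAut, autOfValues]
  map_lam_self := by simp [zetaAut, autOfValues]
  map_mu_self := by simp [zetaAut, autOfValues]
  map_gam j h := absurd (Subsingleton.elim j 0) h
  map_lam j h := absurd (Subsingleton.elim j 0) h
  map_mu j h := absurd (Subsingleton.elim j 0) h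

end FrameGroup

/-! ### Covering semigroups as braid systems -/

namespace Equipment

open FrameGroup

variable {G : Type*} [Group G] (E : Equipment G) (H : AdmissibleCollection)

open Classical in
/-- The element `x_g`, and `1` if `g ∉ O`. -/
noncomputable def xElt (g : G) : E.Covering H :=
  if hg : g ∈ E.O then PresentedMonoid.of _ (Letter.x g hg) else 1

/-- The element `y_{a,b}`. -/
def yElt (a b : G) : E.Covering H := PresentedMonoid.of _ (Letter.y a b)

theorem xElt_of_mem {g : G} (hg : g ∈ E.O) :
    E.xElt H g = PresentedMonoid.of _ (Letter.x g hg) := dif_pos hg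

theorem conj_mem_O' {g : G} (hg : g ∈ E.O) (c : G) : c * g * c⁻¹ ∈ E.O := by
  simpa using E.conj_mem_O c⁻¹ hg

theorem mk_word {n p : ℕ} (f : E.EqHom n p) :
    PresentedMonoid.mk (E.Rel H) f.word =
      (List.ofFn fun i => E.xElt H (f.hom (gam i))).prod *
        (List.ofFn fun j => E.yElt H (f.hom (lam j)) (f.hom (mu j))).prod := by
  have hl : ∀ l : List E.Letter, PresentedMonoid.mk (E.Rel H) (FreeMonoid.ofList l) =
      (l.map (PresentedMonoid.of (E.Rel H))).prod := by
    intro l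
    induction l with
    | nil => exact map_one _
    | cons a l ih => rw [FreeMonoid.ofList_cons, map_mul, ih, List.map_cons, List.prod_cons]; rfl
  rw [EqHom.word, hl, List.map_append, List.prod_append, List.map_ofFn, List.map_ofFn]
  congr 3
  funext i
  exact (E.xElt_of_mem H (f.mem i)).symm

/-- Only automorphisms from the braid group are evaluated, so the identities obtained from it hold
for every admissible collection. -/
theorem mk_word_comp {n p : ℕ} (f : E.EqHom n p) {h : MulAut (FrameGroup n p)}
    (hh : h ∈ braidGroup n p) :
    (List.ofFn fun i => E.xElt H (f.hom (gam i))).prod *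
        (List.ofFn fun j => E.yElt H (f.hom (lam j)) (f.hom (mu j))).prod =
      (List.ofFn fun i => E.xElt H (f.hom (h (gam i)))).prod *
        (List.ofFn fun j => E.yElt H (f.hom (h (lam j))) (f.hom (h (mu j)))).prod := by
  have := PresentedMonoid.mk_eq_mk_of_rel (Rel.admis (E := E) n p h (H.braid_le n p hh) f)
  rwa [mk_word, mk_word] at this

theorem xElt_mul_xElt {g h : G} (hg : g ∈ E.O) (hh : h ∈ E.O) :
    E.xElt H g * E.xElt H h = E.xElt H h * E.xElt H (h⁻¹ * g * h) := by
  let f : E.EqHom 2 0 := ⟨ofValues ![g, h] Fin.elim0 Fin.elim0, fun i => by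
    fin_cases i <;> simpa⟩
  have := E.mk_word_comp H f (Subgroup.subset_closure (Or.inl ⟨0, 1, isSigma_sigmaAut⟩))
  simpa [f, List.ofFn_succ, isSigma_sigmaAut.map_i, isSigma_sigmaAut.map_i'] using this

theorem xElt_mul_yElt_of_mem {g a b : G} (hg : g ∈ E.O) {h : MulAut (FrameGroup 1 1)}
    (hh : h ∈ braidGroup 1 1) :
    let f := ofValues (n := 1) (p := 1) (fun _ => g) (fun _ => a) (fun _ => b)
    E.xElt H g * E.yElt H a b =
      E.xElt H (f (h (gam 0))) * E.yElt H (f (h (lam 0))) (f (h (mu 0))) := by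
  intro f
  have := E.mk_word_comp H (n := 1) (p := 1) ⟨f, fun i => by simpa [f] using hg⟩ hh
  simpa [f, List.ofFn_succ] using this

theorem xElt_mul_yElt_lam {g : G} (hg : g ∈ E.O) (a b : G) :
    E.xElt H g * E.yElt H a b =
      E.xElt H (g * (a * b * a⁻¹) * g * (a * b * a⁻¹)⁻¹ * g⁻¹) * E.yElt H (g * a) b := by
  have hz := isXiLam_xiLamAut
  have := E.xElt_mul_yElt_of_mem H (a := a) (b := b) hg
    (Subgroup.subset_closure (Or.inr (Or.inl ⟨0, 0, hz⟩)))
  have h1 := hz.map_moved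
  have h2 := hz.map_lam_self
  simp only [Fin.val_zero, moved_zero] at h1 h2
  simpa [h1, h2, hz.map_mu, mul_assoc] using this

theorem xElt_mul_yElt_mu {g : G} (hg : g ∈ E.O) (a b : G) :
    E.xElt H g * E.yElt H a b =
      E.xElt H (a * (⁅a, b⁆⁻¹ * g * ⁅a, b⁆) * a⁻¹) *
        E.yElt H a ((⁅a, b⁆⁻¹ * g * ⁅a, b⁆)⁻¹ * b) := by
  have := E.xElt_mul_yElt_of_mem H (a := a) (b := b) hg
    (Subgroup.subset_closure (Or.inr (Or.inr (Or.inl ⟨0, 0, isXiMu_xiMuAut⟩))))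
  simpa [xiMuAut, autOfValues, commutatorElement_def] using this

theorem xElt_mul_yElt_zeta {g : G} (hg : g ∈ E.O) (a b : G) :
    E.xElt H g * E.yElt H a b =
      E.xElt H (⁅a, b⁆⁻¹ * g * ⁅a, b⁆) *
        E.yElt H ((⁅a, b⁆⁻¹ * g * ⁅a, b⁆)⁻¹ * a * (⁅a, b⁆⁻¹ * g * ⁅a, b⁆))
          ((⁅a, b⁆⁻¹ * g * ⁅a, b⁆)⁻¹ * b * (⁅a, b⁆⁻¹ * g * ⁅a, b⁆)) := by
  have := E.xElt_mul_yElt_of_mem H (a := a) (b := b) hg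
    (Subgroup.subset_closure (Or.inr (Or.inr (Or.inr ⟨0, 0, isZeta_zetaAut⟩))))
  simpa [zetaAut, autOfValues, zetaConj, moved_zero, commutatorElement_def] using this

theorem xElt_mul_yElt {g : G} (hg : g ∈ E.O) (a b : G) :
    E.xElt H g * E.yElt H a b = E.yElt H a b * E.xElt H (⁅a, b⁆⁻¹ * g * ⁅a, b⁆) := by
  rw [E.xElt_of_mem H hg, E.xElt_of_mem H (E.conj_mem_O ⁅a, b⁆ hg)]
  exact PresentedMonoid.mk_eq_mk_of_rel (Rel.swap g hg a b)

theorem yElt_mul_xElt {c : G} (hc : c ∈ E.O) (a b : G) :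
    E.yElt H a b * E.xElt H c = E.xElt H (⁅a, b⁆ * c * ⁅a, b⁆⁻¹) * E.yElt H a b := by
  rw [E.xElt_mul_yElt H (E.conj_mem_O' hc _)]
  congr 2
  group

/-- Moving `x_c` to the left conjugates it by `[a, b]`, and `ζ` takes this back. Thus `c` passes
unchanged and the conjugation falls on `a` and `b`. -/
theorem yElt_mul_xElt_zeta {c : G} (hc : c ∈ E.O) (a b : G) :
    E.yElt H a b * E.xElt H c = E.xElt H c * E.yElt H (c⁻¹ * a * c) (c⁻¹ * b * c) := by
  rw [E.yElt_mul_xElt H hc, E.xElt_mul_yElt_zeta H (E.conj_mem_O' hc _)]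
  have : ⁅a, b⁆⁻¹ * (⁅a, b⁆ * c * ⁅a, b⁆⁻¹) * ⁅a, b⁆ = c := by group
  rw [this]

theorem induction_xy {p : E.Covering H → Prop} (one : p 1)
    (x : ∀ g ∈ E.O, ∀ m, p m → p (E.xElt H g * m)) (y : ∀ a b m, p m → p (E.yElt H a b * m))
    (m : E.Covering H) : p m := by
  induction m using PresentedMonoid.induction_left with
  | one => exact one
  | mul l m ih =>
    cases l with
    | x g hg => rw [← E.xElt_of_mem H hg]; exact x g hg m ih
    | y a b => exact y a b m ih

theorem prodHom_xElt {g : G} (hg : g ∈ E.O) : E.prodHom H (E.xElt H g) = g := by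
  rw [E.xElt_of_mem H hg]; rfl

theorem prodHom_yElt (a b : G) : E.prodHom H (E.yElt H a b) = ⁅a, b⁆ := rfl

theorem genSubgroup_mul (m m' : E.Covering H) :
    genSubgroup (m * m') = genSubgroup m ⊔ genSubgroup m' := by
  induction m using PresentedMonoid.inductionOn with
  | h u =>
    induction m' using PresentedMonoid.inductionOn with
    | h v => exact wordSubgroup_mul u v

theorem genSubgroup_one : genSubgroup (1 : E.Covering H) = ⊥ := by
  change wordSubgroup (1 : FreeMonoid E.Letter) = ⊥
  simp [wordSubgroup]

theorem genSubgroup_xElt {g : G} (hg : g ∈ E.O) :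
    genSubgroup (E.xElt H g) = Subgroup.zpowers g := by
  rw [E.xElt_of_mem H hg, Subgroup.zpowers_eq_closure]
  exact wordSubgroup_of _

theorem genSubgroup_yElt (a b : G) :
    genSubgroup (E.yElt H a b) = Subgroup.closure {a, b} := wordSubgroup_of (Letter.y a b)

theorem mul_xElt (m : E.Covering H) : ∀ g ∈ E.O,
    m * E.xElt H g = E.xElt H (E.prodHom H m * g * (E.prodHom H m)⁻¹) * m := by
  induction m using E.induction_xy H with
  | one => intro g _; simp
  | x h hh m ih =>
    intro g hg
    have h1 := E.conj_mem_O' hg (E.prodHom H m)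
    rw [mul_assoc, ih g hg, ← mul_assoc, map_mul, E.prodHom_xElt H hh]
    have := E.xElt_mul_xElt H (E.conj_mem_O' h1 h) hh
    have e : h⁻¹ * (h * (E.prodHom H m * g * (E.prodHom H m)⁻¹) * h⁻¹) * h
      = E.prodHom H m * g * (E.prodHom H m)⁻¹ := by group
    rw [e] at this
    rw [← this, mul_assoc]
    congr 2
    group
  | y a b m ih =>
    intro g hg
    have h1 := E.conj_mem_O' hg (E.prodHom H m)
    rw [mul_assoc, ih g hg, ← mul_assoc, map_mul, E.prodHom_yElt, E.yElt_mul_xElt H h1, mul_assoc]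
    congr 2
    group

/-- Passing the `k` letters across `x_h` conjugates `h` by `g ^ k`; passing them across `y_{a,b}` by
means of `ζ` conjugates `a` and `b` by `g ^ k`. Both conjugations are trivial. -/
theorem commute_xElt_pow {g : G} (hg : g ∈ E.O) {k : ℕ} (hk : g ^ k = 1) (m : E.Covering H) :
    Commute (E.xElt H g ^ k) m := by
  induction m using E.induction_xy H with
  | one => exact Commute.one_right _
  | x h hh m ih =>
    refine Commute.mul_right ?_ ih
    have := E.mul_xElt H (E.xElt H g ^ k) h hh
    rw [map_pow, E.prodHom_xElt H hg, hk] at this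
    rw [commute_iff_eq]
    simpa using this
  | y a b m ih =>
    refine Commute.mul_right ?_ ih
    have key : ∀ j : ℕ, E.yElt H a b * E.xElt H g ^ j =
        E.xElt H g ^ j * E.yElt H ((g ^ j)⁻¹ * a * g ^ j) ((g ^ j)⁻¹ * b * g ^ j) := by
      intro j
      induction j with
      | zero => simp
      | succ j ih =>
        rw [pow_succ, ← mul_assoc, ih, mul_assoc, E.yElt_mul_xElt_zeta H hg, ← mul_assoc]
        congr 2 <;> (rw [pow_succ]; group)
    have := key k
    rw [hk] at this
    rw [commute_iff_eq]
    simpa using this.symm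

/-- The letters `x_g` of a covering semigroup. -/
noncomputable def preSystem : PreBraidSystem E.O (E.Covering H) where
  prod := E.prodHom H
  X := E.xElt H
  gen := genSubgroup
  conj_mem _ hg c := E.conj_mem_O' hg c
  prod_X _ hg := E.prodHom_xElt H hg
  gen_X _ hg := E.genSubgroup_xElt H hg
  gen_mul := E.genSubgroup_mul H
  mul_X g hg m := E.mul_xElt H m g hg
  commute_pow _ hg _ hk m := E.commute_xElt_pow H hg hk m

/-- This is `ξ_λ` iterated. If `g ^ k = 1`, the `y` returns to itself while the block in front has
been conjugated by `a b a⁻¹`. -/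
theorem pow_mul_yElt_lam {g : G} (hg : g ∈ E.O) (a b : G) (k : ℕ) :
    E.xElt H g ^ k * E.yElt H a b =
      E.xElt H (g ^ k * (a * b * a⁻¹) * (g ^ k)⁻¹ * g * (g ^ k * (a * b * a⁻¹) * (g ^ k)⁻¹)⁻¹) ^ k *
        E.yElt H (g ^ k * a) b := by
  induction k with
  | zero => simp
  | succ k ih =>
    set v := g ^ k * (a * b * a⁻¹) * (g ^ k)⁻¹ with hv
    have hvO : v * g * v⁻¹ ∈ E.O := E.conj_mem_O' hg v
    -- The next `x_g` must cross the block of `k` letters already made to reach the `y`. By `e1` and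
    -- `e2`, the crossed block and the letter that `ξ_λ` then produces have the same index.
    have h1 := (E.preSystem H).mul_X_pow hvO (E.xElt H g) k
    change E.xElt H g * E.xElt H _ ^ k
      = E.xElt H (E.prodHom H (E.xElt H g) * _ * (E.prodHom H (E.xElt H g))⁻¹) ^ k * _ at h1
    rw [E.prodHom_xElt H hg] at h1
    have e1 : g * (g ^ k * a * b * (g ^ k * a)⁻¹) * g * (g ^ k * a * b * (g ^ k * a)⁻¹)⁻¹ * g⁻¹ =
        g ^ (k + 1) * (a * b * a⁻¹) * (g ^ (k + 1))⁻¹ * g *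
          (g ^ (k + 1) * (a * b * a⁻¹) * (g ^ (k + 1))⁻¹)⁻¹ := by rw [pow_succ']; group
    have e2 : g * (v * g * v⁻¹) * g⁻¹ = g ^ (k + 1) * (a * b * a⁻¹) * (g ^ (k + 1))⁻¹ * g *
          (g ^ (k + 1) * (a * b * a⁻¹) * (g ^ (k + 1))⁻¹)⁻¹ := by rw [hv, pow_succ']; group
    generalize g ^ (k + 1) * (a * b * a⁻¹) * (g ^ (k + 1))⁻¹ * g *
      (g ^ (k + 1) * (a * b * a⁻¹) * (g ^ (k + 1))⁻¹)⁻¹ = u at e1 e2 ⊢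
    rw [pow_succ', mul_assoc, ih, ← mul_assoc, h1, mul_assoc, E.xElt_mul_yElt_lam H hg, e1, e2,
      pow_succ (E.xElt H u), mul_assoc, ← mul_assoc g, ← pow_succ']

/-- The relation of `ξ_μ` with the `x` on the right of the `y`: in this form `b` is multiplied by
`c⁻¹` itself, which makes it easy to iterate. -/
theorem yElt_mul_mu {c : G} (hc : c ∈ E.O) (a b : G) :
    E.yElt H a b * E.xElt H c =
      E.yElt H a (c⁻¹ * b) * E.xElt H (c⁻¹ * (b * a * b⁻¹) * c * (b * a * b⁻¹)⁻¹ * c) := by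
  have e : ⁅a, b⁆⁻¹ * (⁅a, b⁆ * c * ⁅a, b⁆⁻¹) * ⁅a, b⁆ = c := by group
  rw [E.yElt_mul_xElt H hc, E.xElt_mul_yElt_mu H (E.conj_mem_O' hc _), e,
    E.xElt_mul_yElt H (E.conj_mem_O' hc a)]
  congr 2
  simp only [commutatorElement_def]
  group

theorem yElt_mul_pow_mu {c : G} (hc : c ∈ E.O) (a b : G) (k : ℕ) :
    E.yElt H a b * E.xElt H c ^ k = E.yElt H a ((c ^ k)⁻¹ * b) *
      E.xElt H (((c ^ k)⁻¹ * (b * a * b⁻¹) * c ^ k) * c *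
        ((c ^ k)⁻¹ * (b * a * b⁻¹) * c ^ k)⁻¹) ^ k := by
  induction k with
  | zero => simp
  | succ k ih =>
    set v := (c ^ k)⁻¹ * (b * a * b⁻¹) * c ^ k with hv
    have hvO : c⁻¹ * (v * c * v⁻¹) * c ∈ E.O := E.conj_mem_O c (E.conj_mem_O' hc v)
    have h1 := (E.preSystem H).mul_X_pow hvO (E.xElt H c) k
    change E.xElt H c * E.xElt H _ ^ k
      = E.xElt H (E.prodHom H (E.xElt H c) * _ * (E.prodHom H (E.xElt H c))⁻¹) ^ k * _ at h1
    rw [E.prodHom_xElt H hc] at h1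
    have e0 : c * (c⁻¹ * (v * c * v⁻¹) * c) * c⁻¹ = v * c * v⁻¹ := by group
    rw [e0] at h1
    have e1 : c⁻¹ * ((c ^ k)⁻¹ * b * a * ((c ^ k)⁻¹ * b)⁻¹) * c *
        ((c ^ k)⁻¹ * b * a * ((c ^ k)⁻¹ * b)⁻¹)⁻¹ * c =
        ((c ^ (k + 1))⁻¹ * (b * a * b⁻¹) * c ^ (k + 1)) * c *
        ((c ^ (k + 1))⁻¹ * (b * a * b⁻¹) * c ^ (k + 1))⁻¹ := by rw [pow_succ]; group
    have e2 : c⁻¹ * (v * c * v⁻¹) * c =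
        ((c ^ (k + 1))⁻¹ * (b * a * b⁻¹) * c ^ (k + 1)) * c *
        ((c ^ (k + 1))⁻¹ * (b * a * b⁻¹) * c ^ (k + 1))⁻¹ := by rw [hv, pow_succ]; group
    rw [pow_succ, ← mul_assoc, ih, mul_assoc, ← h1, ← mul_assoc, E.yElt_mul_mu H hc, e1, e2,
      mul_assoc, ← pow_succ', ← mul_assoc c⁻¹, ← mul_inv_rev, ← pow_succ]

/-- The braid system of a covering semigroup. -/
noncomputable def system : BraidSystem E.O (E.Covering H) where
  toPreBraidSystem := E.preSystem H
  gen_le_stab m := by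
    set B := E.preSystem H
    induction m using E.induction_xy H with
    | one =>
      change genSubgroup (1 : E.Covering H) ≤ _
      rw [E.genSubgroup_one]
      exact bot_le
    | x g hg m ih =>
      rw [B.gen_mul]
      refine sup_le ?_ (ih.trans (B.stab_le_stab_mul_left _ _))
      refine le_trans ?_ (B.stab_le_stab_mul_right _ _)
      change genSubgroup (E.xElt H g) ≤ _
      rw [E.genSubgroup_xElt H hg, Subgroup.zpowers_le]
      have := B.prod_mem_stab (E.xElt H g)
      rwa [show B.prod (E.xElt H g) = g from E.prodHom_xElt H hg] at this
    | y a b m ih =>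
      rw [B.gen_mul]
      refine sup_le ?_ (ih.trans (B.stab_le_stab_mul_left _ _))
      refine le_trans ?_ (B.stab_le_stab_mul_right _ _)
      change genSubgroup (E.yElt H a b) ≤ _
      set S := B.stab (E.yElt H a b) with hS
      -- The relations `ξ_λ` and `ξ_μ` and the product of the letter give `a b a⁻¹`, `b a b⁻¹` and
      -- `[a, b]` in `S`; the first and third yield `b`, and then the second yields `a`.
      have h1 : a * b * a⁻¹ ∈ S := by
        intro g hg k hk
        change E.xElt H g ^ k * _ = E.xElt H _ ^ k * _
        have := E.pow_mul_yElt_lam H hg a b k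
        rw [hk] at this
        simpa using this
      have h2 : b * a * b⁻¹ ∈ S := by
        intro g hg k hk
        have := E.yElt_mul_pow_mu H hg a b k
        rw [hk] at this
        rw [(B.commute_pow g hg k hk _).eq,
          (B.commute_pow _ (B.conj_mem g hg _) k (by rw [conj_pow, hk]; group) _).eq]
        change _ * E.xElt H g ^ k = _ * E.xElt H _ ^ k
        simpa using this
      have h3 : ⁅a, b⁆ ∈ S := B.prod_mem_stab (E.yElt H a b)
      have hb : b ∈ S := by
        have := S.inv_mem (S.mul_mem (S.inv_mem h1) h3)
        rw [commutatorElement_def] at this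
        simpa [mul_assoc] using this
      have ha : a ∈ S := by
        have := S.mul_mem (S.mul_mem (S.inv_mem hb) h2) hb
        simpa [mul_assoc] using this
      rw [E.genSubgroup_yElt, Subgroup.closure_le]
      rintro _ (rfl | rfl)
      · exact ha
      · exact hb

end Equipment

namespace BraidSystem

variable {G : Type*} [Group G] {O : Set G} {M : Type*} [Monoid M] (B : BraidSystem O M)

theorem mul_listX (m : M) {l : List G} (hl : ∀ g ∈ l, g ∈ O) :
    m * B.listX l = B.listX (l.map fun g => B.prod m * g * (B.prod m)⁻¹) * m := by
  induction l with
  | nil => simp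
  | cons g l ih =>
    simp only [List.forall_mem_cons] at hl
    rw [listX_cons, ← mul_assoc, B.mul_X g hl.1, mul_assoc, ih hl.2]
    simp [mul_assoc]

theorem Good.mono {O' : Set G} {C : Finset G} {N : ℕ} (hG : Good O C N) (h : ∀ g ∈ C, g ∈ O') :
    Good O' C N :=
  ⟨hG.conj_mem, h, hG.isConj, hG.nonempty, hG.pow_eq_one, hG.ne_zero, hG.closure⟩

end BraidSystem

namespace Equipment

open BraidSystem

variable {G : Type*} [Group G] (E : Equipment G) (H : AdmissibleCollection)

/-! ### Letters `y_{a,b}` -/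

/-- The product of the elements `y_{a,b}` over a list of pairs. -/
def listY (l : List (G × G)) : E.Covering H := (l.map fun x => E.yElt H x.1 x.2).prod

@[simp] theorem listY_nil : E.listY H [] = 1 := rfl

@[simp] theorem listY_cons (x : G × G) (l : List (G × G)) :
    E.listY H (x :: l) = E.yElt H x.1 x.2 * E.listY H l := by
  simp [listY]

/-- `y_{a',b'}` can replace `y_{a,b}` at the cost of changing a sufficiently long list of elements
of `C` in front of it. -/
def ReplaceY (C : Finset G) (T : ℕ) (a b a' b' : G) : Prop :=
  ∀ (l : List G) (m : E.Covering H), (∀ g ∈ l, g ∈ C) → T ≤ l.length →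
    genSubgroup ((E.system H).listX l * (E.yElt H a b * m)) = ⊤ →
    ∃ l' : List G, (∀ g ∈ l', g ∈ C) ∧ l'.length = l.length ∧
      (E.system H).listX l * (E.yElt H a b * m) = (E.system H).listX l' * (E.yElt H a' b' * m)

variable {E H} {C : Finset G} {N : ℕ}

theorem ReplaceY.refl (T : ℕ) (a b : G) : E.ReplaceY H C T a b a b :=
  fun l _ hl _ _ => ⟨l, hl, rfl, rfl⟩

theorem ReplaceY.trans {T : ℕ} {a b a' b' a'' b'' : G} (h : E.ReplaceY H C T a b a' b')
    (h' : E.ReplaceY H C T a' b' a'' b'') : E.ReplaceY H C T a b a'' b'' := by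
  intro l m hl hT htop
  obtain ⟨l', hl', hlen, heq⟩ := h l m hl hT htop
  obtain ⟨l'', hl'', hlen', heq'⟩ := h' l' m hl' (by omega) (heq ▸ htop)
  exact ⟨l'', hl'', hlen'.trans hlen, heq.trans heq'⟩

/-- The letter `g` needed for the relation is produced from the list just before the `y`, and `g'`
goes back into the list. -/
theorem ReplaceY.of_eq (hG : Good E.O C N) {a b a' b' g g' : G} (hg : g ∈ C) (hg' : g' ∈ C)
    (h : E.xElt H g * E.yElt H a b = E.xElt H g' * E.yElt H a' b') :
    E.ReplaceY H C (bound C N 1) a b a' b' := by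
  intro l m hl hT htop
  obtain ⟨l', hl', hlen, heq⟩ := (E.system H).regenerate_one hG l hl hT _ htop hg
  refine ⟨l' ++ [g'], ?_, by simpa using hlen, ?_⟩
  · intro x hx
    rcases List.mem_append.1 hx with hx | hx
    · exact hl' x hx
    · rw [List.mem_singleton.1 hx]; exact hg'
  · rw [heq, listX_append]
    change _ * (E.xElt H g * _) = _
    rw [← mul_assoc (E.xElt H g), h]
    simp only [listX_cons, listX_nil, mul_one, mul_assoc]
    rfl

theorem ReplaceY.mul_left (hG : Good E.O C N) (h a b : G) :
    E.ReplaceY H C (bound C N 1) a b (h * a) b := by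
  refine hG.induction (p := fun h => ∀ a, E.ReplaceY H C (bound C N 1) a b (h * a) b)
    ?_ ?_ ?_ h a
  · intro a; simpa using ReplaceY.refl _ a b
  · intro g hg a
    refine ReplaceY.of_eq hG hg ?_ (E.xElt_mul_yElt_lam H (hG.subset g hg) a b)
    have := hG.conj_mem g hg (g * (a * b * a⁻¹))
    rwa [mul_inv_rev, ← mul_assoc] at this
  · intro g h hg hh a
    have := (hh a).trans (hg (h * a))
    rwa [← mul_assoc] at this

theorem ReplaceY.inv_mul_right (hG : Good E.O C N) (h a b : G) :
    E.ReplaceY H C (bound C N 1) a b a (h⁻¹ * b) := by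
  refine hG.induction (p := fun h => ∀ b, E.ReplaceY H C (bound C N 1) a b a (h⁻¹ * b))
    ?_ ?_ ?_ h b
  · intro b; simpa using ReplaceY.refl _ a b
  · intro c hc b
    -- The letter `[a, b] c [a, b]⁻¹` is chosen so that `ξ_μ` multiplies `b` by exactly `c⁻¹`.
    have hg := hG.conj_mem c hc ⁅a, b⁆
    have e : ⁅a, b⁆⁻¹ * (⁅a, b⁆ * c * ⁅a, b⁆⁻¹) * ⁅a, b⁆ = c := by group
    have := E.xElt_mul_yElt_mu H (hG.subset _ hg) a b
    rw [e] at this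
    exact ReplaceY.of_eq hG hg (hG.conj_mem c hc a) this
  · intro g h hg hh b
    have := (hg b).trans (hh (g⁻¹ * b))
    rwa [← mul_assoc, ← mul_inv_rev] at this

theorem ReplaceY.one_one (hG : Good E.O C N) (a b : G) :
    E.ReplaceY H C (bound C N 1) a b 1 1 := by
  have h1 := ReplaceY.mul_left (H := H) hG a⁻¹ a b
  have h2 := ReplaceY.inv_mul_right (H := H) hG b 1 b
  rw [inv_mul_cancel] at h1 h2
  exact h1.trans h2

theorem genSubgroup_yElt_one : genSubgroup (E.yElt H 1 1) = ⊥ := by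
  rw [genSubgroup_yElt]
  simp

theorem yElt_one_mul_listX {l : List G} (hl : ∀ g ∈ l, g ∈ E.O) :
    E.yElt H 1 1 * (E.system H).listX l = (E.system H).listX l * E.yElt H 1 1 := by
  have h : (E.system H).prod (E.yElt H 1 1) = 1 := by
    change E.prodHom H (E.yElt H 1 1) = 1
    rw [prodHom_yElt]; simp
  rw [(E.system H).mul_listX _ hl, h]
  simp

/-- Once a `y` has become `y_{1,1}`, it commutes with the list and contributes nothing to the
generated subgroup. It can be taken out in front, and the remaining word still generates. -/
theorem exists_listX_mul_listY (hG : Good E.O C N) (ys : List (G × G)) :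
    ∀ (l : List G) (m : E.Covering H), (∀ g ∈ l, g ∈ C) → bound C N 1 ≤ l.length →
      genSubgroup ((E.system H).listX l * (E.listY H ys * m)) = ⊤ →
      ∃ l' : List G, (∀ g ∈ l', g ∈ C) ∧ l'.length = l.length ∧
        genSubgroup ((E.system H).listX l' * m) = ⊤ ∧
        (E.system H).listX l * (E.listY H ys * m)
          = E.yElt H 1 1 ^ ys.length * ((E.system H).listX l' * m) := by
  induction ys with
  | nil => intro l m hl _ htop; exact ⟨l, hl, rfl, by simpa using htop, by simp⟩
  | cons y ys ih =>
    intro l m hl hT htop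
    rw [listY_cons, mul_assoc] at htop ⊢
    obtain ⟨l₁, hl₁, hlen₁, heq₁⟩ := ReplaceY.one_one hG y.1 y.2 l _ hl hT htop
    rw [heq₁, ← mul_assoc, ← yElt_one_mul_listX fun g hg => hG.subset g (hl₁ g hg),
      mul_assoc] at htop ⊢
    rw [genSubgroup_mul, genSubgroup_yElt_one, bot_sup_eq] at htop
    obtain ⟨l₂, hl₂, hlen₂, htop₂, heq₂⟩ := ih l₁ m hl₁ (by omega) htop
    refine ⟨l₂, hl₂, hlen₂.trans hlen₁, htop₂, ?_⟩
    rw [heq₂, List.length_cons, pow_succ', mul_assoc]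

/-! ### Normal forms, types and genera -/

theorem type_mul (u v : E.Covering H) : type (u * v) = type u + type v := by
  rw [type, map_mul]; rfl

theorem genus_mul (u v : E.Covering H) : genus (u * v) = genus u + genus v := by
  rw [genus, map_mul]; rfl

theorem type_one : type (1 : E.Covering H) = 0 := by
  rw [type, map_one]; rfl

theorem genus_one : genus (1 : E.Covering H) = 0 := by
  rw [genus, map_one]; rfl

open Classical in
theorem type_xElt {g : G} (hg : g ∈ E.O) (i : Fin E.m) :
    type (E.xElt H g) i = if g ∈ (E.C i).carrier then 1 else 0 := by
  rw [xElt_of_mem E H hg]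
  rfl

theorem genus_xElt {g : G} (hg : g ∈ E.O) : genus (E.xElt H g) = 0 := by
  rw [xElt_of_mem E H hg]
  rfl

theorem type_yElt (a b : G) : type (E.yElt H a b) = 0 := rfl

theorem genus_yElt (a b : G) : genus (E.yElt H a b) = 1 := rfl

open Classical in
theorem type_listX {l : List G} (hl : ∀ g ∈ l, g ∈ E.O) (i : Fin E.m) :
    type ((E.system H).listX l) i = l.countP fun g => g ∈ (E.C i).carrier := by
  induction l with
  | nil => rw [listX_nil, type_one]; rfl
  | cons g l ih =>
    simp only [List.forall_mem_cons] at hl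
    rw [listX_cons, type_mul, Pi.add_apply, ih hl.2, List.countP_cons,
      show (E.system H).X g = E.xElt H g from rfl, type_xElt hl.1, add_comm]
    simp

theorem genus_listX {l : List G} (hl : ∀ g ∈ l, g ∈ E.O) : genus ((E.system H).listX l) = 0 := by
  induction l with
  | nil => exact genus_one
  | cons g l ih =>
    simp only [List.forall_mem_cons] at hl
    rw [listX_cons, genus_mul, ih hl.2, show (E.system H).X g = E.xElt H g from rfl,
      genus_xElt hl.1]

theorem type_listY (l : List (G × G)) : type (E.listY H l) = 0 := by
  induction l with
  | nil => exact type_one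
  | cons x l ih => rw [listY_cons, type_mul, ih, type_yElt, add_zero]

theorem genus_listY (l : List (G × G)) : genus (E.listY H l) = l.length := by
  induction l with
  | nil => exact genus_one
  | cons x l ih => rw [listY_cons, genus_mul, ih, genus_yElt, List.length_cons, add_comm]

theorem prodHom_listY (l : List (G × G)) :
    E.prodHom H (E.listY H l) = (l.map fun x => ⁅x.1, x.2⁆).prod := by
  induction l with
  | nil => simp
  | cons x l ih => rw [listY_cons, map_mul, ih, prodHom_yElt]; simp

/-- Letters of `C` move left across the `y`s and the other `x`s move right. Conjugation respects
membership in `C`, so the sorting is preserved. -/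
theorem exists_normal_form (hC : ∀ g ∈ C, ∀ c : G, c * g * c⁻¹ ∈ C) (hCO : ∀ g ∈ C, g ∈ E.O)
    (z : E.Covering H) :
    ∃ (l : List G) (ys : List (G × G)) (w : List G), (∀ g ∈ l, g ∈ C) ∧
      (∀ g ∈ w, g ∈ E.O ∧ g ∉ C) ∧
      z = (E.system H).listX l * (E.listY H ys * (E.system H).listX w) := by
  induction z using E.induction_xy H with
  | one => exact ⟨[], [], [], by simp⟩
  | x g hg m ih =>
    obtain ⟨l, ys, w, hl, hw, rfl⟩ := ih
    by_cases hgC : g ∈ C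
    · refine ⟨g :: l, ys, w, ?_, hw, ?_⟩
      · simpa using ⟨hgC, hl⟩
      · rw [listX_cons, mul_assoc]
        rfl
    · set c := (E.system H).prod ((E.system H).listX l * E.listY H ys) with hc
      refine ⟨l, ys, (c⁻¹ * g * c) :: w, hl, ?_, ?_⟩
      · simp only [List.forall_mem_cons]
        refine ⟨⟨E.conj_mem_O c hg, fun h => hgC ?_⟩, hw⟩
        have := hC _ h c
        simpa [mul_assoc] using this
      · have := (E.system H).X_mul hg ((E.system H).listX l * E.listY H ys)
        rw [← mul_assoc ((E.system H).listX l), ← mul_assoc]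
        change (E.system H).X g * _ * _ = _
        rw [this, listX_cons]
        simp only [mul_assoc]
        rfl
  | y a b m ih =>
    obtain ⟨l, ys, w, hl, hw, rfl⟩ := ih
    refine ⟨l.map fun g => ⁅a, b⁆ * g * ⁅a, b⁆⁻¹, (a, b) :: ys, w, ?_, hw, ?_⟩
    · intro g hg
      obtain ⟨g', hg', rfl⟩ := List.mem_map.1 hg
      exact hC g' (hl g' hg') _
    · rw [← mul_assoc, (E.system H).mul_listX _ fun g hg => hCO g (hl g hg), listY_cons]
      simp only [mul_assoc]
      rfl

theorem type_listX_of_mem {C₁ : ConjClasses G} {i₁ : Fin E.m} (hi : E.C i₁ = C₁)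
    (hC₁ : ∀ g, g ∈ C ↔ g ∈ C₁.carrier) (hCO : ∀ g ∈ C, g ∈ E.O) {l : List G}
    (hl : ∀ g ∈ l, g ∈ C) :
    type ((E.system H).listX l) = fun i => if i = i₁ then l.length else 0 := by
  classical
  funext i
  rw [type_listX fun g hg => hCO g (hl g hg)]
  split_ifs with h
  · subst h
    rw [List.countP_eq_length]
    intro g hg
    simpa [hi] using (hC₁ g).1 (hl g hg)
  · rw [List.countP_eq_zero]
    intro g hg hgi
    have h1 := (hC₁ g).1 (hl g hg)
    rw [← hi] at h1
    simp only [decide_eq_true_eq] at hgi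
    rw [ConjClasses.mem_carrier_iff_mk_eq] at h1 hgi
    exact h (E.injective (hgi.symm.trans h1))

theorem countP_eq_zero_of_notMem {C₁ : ConjClasses G} {i₁ : Fin E.m} (hi : E.C i₁ = C₁)
    (hC₁ : ∀ g, g ∈ C ↔ g ∈ C₁.carrier) {w : List G} (hw : ∀ g ∈ w, g ∈ E.O ∧ g ∉ C) :
    type ((E.system H).listX w) i₁ = 0 := by
  classical
  rw [type_listX fun g hg => (hw g hg).1, List.countP_eq_zero]
  intro g hg hgi
  refine (hw g hg).2 ((hC₁ g).2 ?_)
  simpa [hi] using hgi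

/-- All letters lie in `O` and outside `C₁`, so the type at the other indices gives the multiplicity
of every class that can occur. -/
theorem perm_map_mk {H' : AdmissibleCollection} {C₁ : ConjClasses G} {i₁ : Fin E.m}
    (hi : E.C i₁ = C₁) (hC₁ : ∀ g, g ∈ C ↔ g ∈ C₁.carrier) {w w' : List G}
    (hw : ∀ g ∈ w, g ∈ E.O ∧ g ∉ C) (hw' : ∀ g ∈ w', g ∈ E.O ∧ g ∉ C)
    (h : ∀ i, i ≠ i₁ →
      type ((E.system H).listX w) i = type ((E.system H').listX w') i) :
    (w.map ConjClasses.mk).Perm (w'.map ConjClasses.mk) := by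
  classical
  rw [List.perm_iff_count]
  intro c
  have hcount : ∀ w : List G, (w.map ConjClasses.mk).count c = w.countP fun g => g ∈ c.carrier := by
    intro w
    rw [List.count, List.countP_map]
    congr 1
    funext g
    rw [Bool.eq_iff_iff]
    simp [ConjClasses.mem_carrier_iff_mk_eq]
  rw [hcount, hcount]
  by_cases hc : ∃ i, i ≠ i₁ ∧ E.C i = c
  · obtain ⟨i, hne, rfl⟩ := hc
    have := h i hne
    rwa [type_listX fun g hg => (hw g hg).1, type_listX fun g hg => (hw' g hg).1] at this
  · have hz : ∀ w : List G, (∀ g ∈ w, g ∈ E.O ∧ g ∉ C) →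
        (w.countP fun g => g ∈ c.carrier) = 0 := by
      intro w hw
      rw [List.countP_eq_zero]
      intro g hg hgc
      simp only [decide_eq_true_eq] at hgc
      obtain ⟨i, hgi⟩ := (hw g hg).1
      have hic : E.C i = c := by
        rw [ConjClasses.mem_carrier_iff_mk_eq] at hgi hgc
        exact hgi.symm.trans hgc
      by_cases hii : i = i₁
      · subst hii
        exact (hw g hg).2 ((hC₁ g).2 (hi ▸ hgi))
      · exact hc ⟨i, hii, hic⟩
    rw [hz w hw, hz w' hw']

/-- The homomorphism from the universal monoid. -/
noncomputable def ofBraidMonoid (E : Equipment G) (H : AdmissibleCollection)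
    (hCO : ∀ g ∈ C, g ∈ E.O) : BraidMonoid C →* E.Covering H :=
  PresentedMonoid.lift (fun g => E.xElt H g.1) (by
    rintro _ _ ⟨g, h, k, hk⟩
    simp only [map_mul, FreeMonoid.lift_eval_of, hk]
    exact E.xElt_mul_xElt H (hCO _ g.2) (hCO _ h.2))

theorem ofBraidMonoid_listX (hC : ∀ g ∈ C, ∀ c : G, c * g * c⁻¹ ∈ C) (hCO : ∀ g ∈ C, g ∈ E.O)
    {l : List G} (hl : ∀ g ∈ l, g ∈ C) :
    ofBraidMonoid E H hCO ((BraidMonoid.system hC).listX l) = (E.system H).listX l := by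
  induction l with
  | nil => simp
  | cons g l ih =>
    simp only [List.forall_mem_cons] at hl
    rw [listX_cons, map_mul, ih hl.2, listX_cons,
      show (BraidMonoid.system hC).X g = BraidMonoid.X C g from rfl, BraidMonoid.X_of_mem hl.1]
    rfl

end Equipment

/-! ### Generation and products in an odd class -/

section OddClass

open Equiv

variable {α : Type*} [Fintype α] [DecidableEq α]

/-- The conjugates of an odd permutation with a fixed point generate the symmetric group. -/
theorem closure_eq_top_of_odd {C : Set (Perm α)} (hC : ∀ g ∈ C, ∀ c, c * g * c⁻¹ ∈ C) {g : Perm α}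
    (hg : g ∈ C) (hodd : Perm.sign g = -1) {a : α} (ha : g a = a) : Subgroup.closure C = ⊤ := by
  have hconj : ∀ s ∈ Subgroup.closure C, ∀ c, c * s * c⁻¹ ∈ Subgroup.closure C := by
    intro s hs c
    induction hs using Subgroup.closure_induction with
    | mem x hx => exact Subgroup.subset_closure (hC x hx c)
    | one => simp
    | mul x y _ _ hx hy => simpa [mul_assoc] using mul_mem hx hy
    | inv x _ hx => simpa [mul_assoc] using inv_mem hx
  obtain ⟨x, hx⟩ : ∃ x, g x ≠ x := by
    by_contra! h
    have : g = 1 := Perm.ext h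
    rw [this, Perm.sign_one] at hodd
    exact absurd hodd (by decide)
  have hxa : a ≠ x := fun h => hx (h ▸ ha)
  have hya : a ≠ g x := fun h => hxa (g.injective (ha.trans h))
  -- With `s = swap a x`, this is `g * (s g s⁻¹)⁻¹`, because `g` conjugates `s` to `swap a (g x)`.
  -- As `a`, `x`, `g x` are distinct, it is a three-cycle.
  have hmem : swap a (g x) * swap a x ∈ Subgroup.closure C := by
    have h1 := mul_mem (Subgroup.subset_closure hg)
      (inv_mem (Subgroup.subset_closure (hC g hg (swap a x))))
    have h2 := swap_apply_apply g a x
    rw [ha] at h2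
    rw [h2]
    simpa [mul_assoc] using h1
  have h3 : ∀ τ : Perm α, τ.IsThreeCycle → τ ∈ Subgroup.closure C := by
    intro τ hτ
    have h4 : (swap a (g x) * swap a x).IsThreeCycle :=
      Perm.isThreeCycle_swap_mul_swap_same hya hxa hx
    obtain ⟨c, rfl⟩ := isConj_iff.1 (Perm.isConj_iff_cycleType_eq.2 (h4.trans hτ.symm))
    exact hconj _ hmem c
  have halt : alternatingGroup α ≤ Subgroup.closure C := by
    rw [← Perm.closure_three_cycles_eq_alternating, Subgroup.closure_le]
    exact h3
  rw [eq_top_iff]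
  intro s _
  rcases Int.units_eq_one_or (Perm.sign s) with hs | hs
  · exact halt (Perm.mem_alternatingGroup.2 hs)
  · have : s * g⁻¹ ∈ Subgroup.closure C :=
      halt (Perm.mem_alternatingGroup.2 (by simp [hs, hodd]))
    simpa using mul_mem this (Subgroup.subset_closure hg)

theorem sign_prod_of_odd {l : List (Perm α)} (hl : ∀ g ∈ l, Perm.sign g = -1) :
    Perm.sign l.prod = (-1) ^ l.length := by
  induction l with
  | nil => simp
  | cons g l ih =>
    simp only [List.forall_mem_cons] at hl
    rw [List.prod_cons, map_mul, hl.1, ih hl.2, List.length_cons, pow_succ']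

open BraidSystem in
/-- Every permutation of the right sign is a product of any large number of elements of `C`. -/
theorem exists_list_prod_eq {O : Set (Perm α)} {C : Finset (Perm α)} {N : ℕ} (hG : Good O C N)
    (hodd : ∀ g ∈ C, Perm.sign g = -1) :
    ∃ T : ℕ, ∀ n, T ≤ n → ∀ σ : Perm α, Perm.sign σ = (-1) ^ n →
      ∃ l : List (Perm α), (∀ g ∈ l, g ∈ C) ∧ l.length = n ∧ l.prod = σ := by
  have hex : ∀ σ : Perm α, ∃ l : List (Perm α), (∀ g ∈ l, g ∈ C) ∧ l.prod = σ := by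
    intro σ
    refine hG.induction (p := fun σ => ∃ l : List (Perm α), (∀ g ∈ l, g ∈ C) ∧ l.prod = σ)
      ⟨[], by simp⟩ (fun g hg => ⟨[g], by simpa using hg⟩) ?_ σ
    rintro _ _ ⟨l, hl, rfl⟩ ⟨l', hl', rfl⟩
    exact ⟨l ++ l', fun g hg => (List.mem_append.1 hg).elim (hl g) (hl' g), by simp⟩
  choose f hf hfp using hex
  obtain ⟨g, hg⟩ := hG.nonempty
  -- A permutation is conjugate to its inverse, so pairs `g`, `g⁻¹` can serve as padding; the
  -- surplus length is even by the sign condition.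
  have hinv : g⁻¹ ∈ C := by
    obtain ⟨c, hc⟩ := isConj_iff.1 (Perm.isConj_iff_cycleType_eq.2 (Perm.cycleType_inv g).symm)
    exact hc ▸ hG.conj_mem g hg c
  refine ⟨Finset.univ.sup fun σ => (f σ).length, fun n hn σ hσ => ?_⟩
  have hle : (f σ).length ≤ n :=
    (Finset.le_sup (f := fun σ => (f σ).length) (Finset.mem_univ σ)).trans hn
  have hsign : (-1 : ℤˣ) ^ (f σ).length = (-1) ^ n := by
    rw [← hσ, ← sign_prod_of_odd fun g hg => hodd g (hf σ g hg), hfp]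
  obtain ⟨k, rfl⟩ := Nat.exists_eq_add_of_le hle
  have heven : Even k := by
    rw [pow_add, left_eq_mul] at hsign
    by_contra h
    rw [(Nat.not_even_iff_odd.1 h).neg_one_pow] at hsign
    exact absurd hsign (by decide)
  obtain ⟨j, rfl⟩ := heven
  refine ⟨f σ ++ (List.replicate j g ++ List.replicate j g⁻¹), ?_, by simp, by simp [hfp]⟩
  intro h hh
  simp only [List.mem_append, List.mem_replicate] at hh
  rcases hh with hh | ⟨-, rfl⟩ | ⟨-, rfl⟩
  · exact hf σ h hh
  · exact hg
  · exact hinv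

theorem sign_prod_commutators (ys : List (Perm α × Perm α)) :
    Perm.sign (ys.map fun x => ⁅x.1, x.2⁆).prod = 1 := by
  induction ys with
  | nil => simp
  | cons y ys ih =>
    rw [List.map_cons, List.prod_cons, map_mul, ih, mul_one, map_commutatorElement,
      commutatorElement_eq_one_iff_mul_comm, mul_comm]

end OddClass

/-! ### Uniqueness and existence of solutions -/

namespace Equipment

open BraidSystem Equiv

variable {α : Type*} [Fintype α] [DecidableEq α] {C : Finset (Perm α)} {N : ℕ}

/-- Solutions are brought to a form that differs only in a list of elements of `C`, and these lists
are compared in the universal monoid, which maps to every covering semigroup. -/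
theorem exists_forall_genSolutions_subsingleton (hG : Good (C : Set (Perm α)) C N)
    {C₁ : ConjClasses (Perm α)} (hC₁ : ∀ g, g ∈ C ↔ g ∈ C₁.carrier) {g₀ : Perm α} (hg₀ : g₀ ∈ C)
    (hodd : Perm.sign g₀ = -1) {a b : α} (hab : a ≠ b) (ha : g₀ a = a) (hb : g₀ b = b) :
    ∃ T : ℕ, ∀ (E : Equipment (Perm α)) (i₁ : Fin E.m), E.C i₁ = C₁ →
      ∀ (σ : Perm α) (t : Fin E.m → ℕ), T ≤ t i₁ → ∀ (H : AdmissibleCollection) (p : ℕ),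
        (E.genSolutions H σ p t).Subsingleton := by
  obtain ⟨T, hT⟩ := BraidMonoid.exists_forall_listX_eq hG hg₀ hodd hab ha hb
  refine ⟨max (bound C N 1) T, fun E i₁ hi σ t ht H p => ?_⟩
  have hCO : ∀ g ∈ C, g ∈ E.O := fun g hg => ⟨i₁, hi ▸ (hC₁ g).1 hg⟩
  have hGE : Good E.O C N := hG.mono hCO
  set B := E.system H with hB
  -- reduction of the `y`s
  have red : ∀ z ∈ E.genSolutions H σ p t, ∃ l w : List (Perm α), (∀ g ∈ l, g ∈ C) ∧
      (∀ g ∈ w, g ∈ E.O ∧ g ∉ C) ∧ l.length = t i₁ ∧ l.prod * w.prod = σ ∧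
      (∀ i, i ≠ i₁ → type (B.listX w) i = t i) ∧ genSubgroup (B.listX l * B.listX w) = ⊤ ∧
      z = E.yElt H 1 1 ^ p * (B.listX l * B.listX w) := by
    rintro z ⟨⟨hσ, hp, htz⟩, htop⟩
    obtain ⟨l, ys, w, hl, hw, rfl⟩ := exists_normal_form hG.conj_mem hCO z
    have hlO : ∀ g ∈ l, g ∈ E.O := fun g hg => hCO g (hl g hg)
    have hwO : ∀ g ∈ w, g ∈ E.O := fun g hg => (hw g hg).1
    rw [genus_mul, genus_mul, genus_listX hlO, genus_listX hwO, genus_listY] at hp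
    rw [type_mul, type_mul, type_listY, zero_add, type_listX_of_mem hi hC₁ hCO hl] at htz
    have hlen : l.length = t i₁ := by
      rw [← htz, Pi.add_apply, countP_eq_zero_of_notMem hi hC₁ hw]
      simp
    obtain ⟨l', hl', hlen', htop', heq⟩ := exists_listX_mul_listY hGE ys l _ hl
      ((le_max_left _ _).trans (hlen ▸ ht)) htop
    have hp' : ys.length = p := by simpa using hp
    rw [hp'] at heq
    refine ⟨l', w, hl', hw, hlen'.trans hlen, ?_, ?_, htop', heq⟩
    · rw [← hσ, heq, map_mul, map_mul, map_pow, prodHom_yElt]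
      change _ = _ * (B.prod (B.listX l') * B.prod (B.listX w))
      rw [B.prod_listX fun g hg => hCO g (hl' g hg), B.prod_listX hwO]
      simp
    · intro i hne
      rw [← htz]
      simp [hne, hB]
  intro z₁ hz₁ z₂ hz₂
  obtain ⟨l₁, w₁, hl₁, hw₁, hlen₁, hprod₁, htype₁, htop₁, rfl⟩ := red z₁ hz₁
  obtain ⟨l₂, w₂, hl₂, hw₂, hlen₂, hprod₂, htype₂, htop₂, rfl⟩ := red z₂ hz₂
  -- a common form of the letters outside `C`
  have hmk : ∀ c : ConjClasses (Perm α), ∃ g, ConjClasses.mk g = c := ConjClasses.exists_rep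
  choose r hr using hmk
  -- Class representatives in the order given by `w₂`; for `w₁` the representatives first have to be
  -- permuted.
  set v := (w₂.map ConjClasses.mk).map r with hv
  have hrc : ∀ g, IsConj g (r (ConjClasses.mk g)) := fun g =>
    ConjClasses.mk_eq_mk_iff_isConj.1 (hr _).symm
  have hrep : ∀ w : List (Perm α), (∀ g ∈ w, g ∈ E.O ∧ g ∉ C) →
      B.Replace C (bound C N 1) w ((w.map ConjClasses.mk).map r) := by
    intro w hw
    rw [List.map_map]
    exact Replace.map_of_isConj hGE _ hrc w fun g hg => (hw g hg).1
  have hmapO : ∀ w : List (Perm α), (∀ g ∈ w, g ∈ E.O ∧ g ∉ C) →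
      ∀ g ∈ (w.map ConjClasses.mk).map r, g ∈ E.O := by
    intro w hw g hg
    rw [List.map_map] at hg
    obtain ⟨h, hh, rfl⟩ := List.mem_map.1 hg
    exact E.mem_O_of_isConj (hrc h).symm (hw h hh).1
  have hperm := perm_map_mk (H := H) (H' := H) hi hC₁ hw₁ hw₂ fun i hne =>
    (htype₁ i hne).trans (htype₂ i hne).symm
  have hR₁ : B.Replace C (bound C N 1) w₁ v :=
    (hrep w₁ hw₁).trans (Replace.of_perm hGE (hperm.map r) (hmapO w₁ hw₁))
  have hvO : ∀ g ∈ v, g ∈ E.O := hmapO w₂ hw₂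
  -- one side
  have side : ∀ l w : List (Perm α), (∀ g ∈ l, g ∈ C) → (∀ g ∈ w, g ∈ E.O) →
      B.Replace C (bound C N 1) w v → l.length = t i₁ → l.prod * w.prod = σ →
      genSubgroup (B.listX l * B.listX w) = ⊤ →
      ∃ L : List (Perm α), (∀ g ∈ L, g ∈ C) ∧ L.length = t i₁ ∧ L.prod * v.prod = σ ∧
        (BraidMonoid.system hG.conj_mem).gen ((BraidMonoid.system hG.conj_mem).listX L) = ⊤ ∧
        B.listX l * B.listX w = B.listX L * B.listX v := by
    intro l w hl hw hR hlen hprod htop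
    obtain ⟨l', hl', hlen', heq⟩ := hR l 1 hl ((le_max_left _ _).trans (hlen ▸ ht))
      (by rw [mul_one]; exact htop)
    rw [mul_one, mul_one] at heq
    -- The whole word generates, but the universal monoid sees only its `C`-part. A copy of `W`
    -- spelled out in that part makes it generate by itself.
    obtain ⟨l'', hl'', hlen'', heq'⟩ := B.regenerate hGE.conj_mem hGE.subset hGE.isConj
      hGE.nonempty hGE.pow_eq_one hGE.ne_zero 1 l' hl'
      ((le_max_left _ _).trans (by rw [hlen', hlen]; exact ht)) (B.listX v)
      (by rw [← heq]; exact htop)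
    have hL : ∀ g ∈ wList C N ++ l'', g ∈ C := fun g hg =>
      (List.mem_append.1 hg).elim mem_of_mem_wList (hl'' g)
    have hfin : B.listX l * B.listX w = B.listX (wList C N ++ l'') * B.listX v := by
      rw [heq, heq', pow_one, listX_append]
      rfl
    refine ⟨wList C N ++ l'', hL, ?_, ?_, ?_, hfin⟩
    · rw [List.length_append]; omega
    · have := congrArg B.prod hfin
      rw [map_mul, map_mul, B.prod_listX (fun g hg => hCO g (hl g hg)), B.prod_listX hw,
        B.prod_listX (fun g hg => hCO g (hL g hg)), B.prod_listX hvO] at this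
      rw [← this, hprod]
    · rw [listX_append]
      exact (BraidMonoid.system hG.conj_mem).gen_W_mul hG _
  obtain ⟨L₁, hL₁, hLlen₁, hLprod₁, hLtop₁, hLeq₁⟩ := side l₁ w₁ hl₁ (fun g hg => (hw₁ g hg).1) hR₁
    hlen₁ hprod₁ htop₁
  obtain ⟨L₂, hL₂, hLlen₂, hLprod₂, hLtop₂, hLeq₂⟩ := side l₂ w₂ hl₂ (fun g hg => (hw₂ g hg).1)
    (hrep w₂ hw₂) hlen₂ hprod₂ htop₂
  have key := hT L₁ L₂ hL₁ hL₂ ((le_max_right _ _).trans (hLlen₁ ▸ ht)) (hLlen₁.trans hLlen₂.symm)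
    (mul_right_cancel (hLprod₁.trans hLprod₂.symm)) hLtop₁ hLtop₂
  have := congrArg (ofBraidMonoid E H hCO) key
  rw [ofBraidMonoid_listX hG.conj_mem hCO hL₁, ofBraidMonoid_listX hG.conj_mem hCO hL₂] at this
  rw [hLeq₁, hLeq₂, hB, this]

/-- Only the product matters: the `C`-letters and commutators of a solution are replaced by `W`, a
list from `C` with the same total product, and trivial `y`s in the required number. -/
theorem exists_forall_genSolutions_nonempty (hG : Good (C : Set (Perm α)) C N)
    {C₁ : ConjClasses (Perm α)} (hC₁ : ∀ g, g ∈ C ↔ g ∈ C₁.carrier)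
    (hodd : ∀ g ∈ C, Perm.sign g = -1) :
    ∃ T : ℕ, ∀ (E : Equipment (Perm α)) (i₁ : Fin E.m), E.C i₁ = C₁ →
      ∀ (σ : Perm α) (t : Fin E.m → ℕ), T ≤ t i₁ → ∀ (H H' : AdmissibleCollection) (p p' : ℕ),
        (E.solutions H σ p t).Nonempty → (E.genSolutions H' σ p' t).Nonempty := by
  obtain ⟨T, hT⟩ := exists_list_prod_eq hG hodd
  refine ⟨T + (wList C N).length, fun E i₁ hi σ t ht H H' p p' ⟨z, hσ, _, htz⟩ => ?_⟩
  have hCO : ∀ g ∈ C, g ∈ E.O := fun g hg => ⟨i₁, hi ▸ (hC₁ g).1 hg⟩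
  have hGE : Good E.O C N := hG.mono hCO
  obtain ⟨l, ys, w, hl, hw, rfl⟩ := exists_normal_form hG.conj_mem hCO z
  have hlO : ∀ g ∈ l, g ∈ E.O := fun g hg => hCO g (hl g hg)
  have hwO : ∀ g ∈ w, g ∈ E.O := fun g hg => (hw g hg).1
  rw [type_mul, type_mul, type_listY, zero_add, type_listX_of_mem hi hC₁ hCO hl] at htz
  have hlen : l.length = t i₁ := by
    rw [← htz, Pi.add_apply, countP_eq_zero_of_notMem hi hC₁ hw]
    simp
  obtain ⟨n, hn⟩ := Nat.exists_eq_add_of_le ((Nat.le_add_left _ T).trans ht)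
  -- A list of odd permutations with product `1` has even length, so reserving letters for `W` does
  -- not change the sign required of the others.
  have hsgnW : (-1 : ℤˣ) ^ (wList C N).length = 1 := by
    rw [← sign_prod_of_odd fun g hg => hodd g (mem_of_mem_wList hg), prod_wList C hG.pow_eq_one,
      Perm.sign_one]
  have hprod : l.prod * (ys.map fun x => ⁅x.1, x.2⁆).prod * w.prod = σ := by
    rw [← hσ, map_mul, map_mul, prodHom_listY, ← mul_assoc]
    congr 1
    · congr 1
      exact ((E.system H).prod_listX hlO).symm
    · exact ((E.system H).prod_listX hwO).symm
  obtain ⟨l', hl', hlen', hprod'⟩ := hT n (by omega)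
    (l.prod * (ys.map fun x => ⁅x.1, x.2⁆).prod) (by
      rw [map_mul, sign_prod_commutators, mul_one, sign_prod_of_odd fun g hg => hodd g (hl g hg),
        hlen, hn, pow_add, hsgnW, one_mul])
  have hL : ∀ g ∈ wList C N ++ l', g ∈ C := fun g hg =>
    (List.mem_append.1 hg).elim mem_of_mem_wList (hl' g)
  have hLO : ∀ g ∈ wList C N ++ l', g ∈ E.O := fun g hg => hCO g (hL g hg)
  refine ⟨(E.system H').listX (wList C N ++ l') *
    (E.listY H' (List.replicate p' (1, 1)) * (E.system H').listX w), ⟨?_, ?_, ?_⟩, ?_⟩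
  · rw [map_mul, map_mul, prodHom_listY]
    change (E.system H').prod _ * (_ * (E.system H').prod _) = _
    rw [(E.system H').prod_listX hLO, (E.system H').prod_listX hwO, List.prod_append,
      prod_wList C hG.pow_eq_one, hprod', one_mul, ← hprod]
    simp
  · rw [genus_mul, genus_mul, genus_listX hLO, genus_listX hwO, genus_listY]
    simp
  · rw [type_mul, type_mul, type_listY, zero_add, type_listX_of_mem hi hC₁ hCO hL, ← htz,
      List.length_append, hlen', hlen, hn]
    congr 1
    classical
    funext i
    rw [type_listX hwO, type_listX hwO]
  · rw [listX_append, mul_assoc]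
    exact (E.system H').gen_W_mul hGE _

end Equipment

theorem mainTheorem6 (d : ℕ) (C₁ : ConjClasses (Equiv.Perm (Fin d))) (σ₁ : Equiv.Perm (Fin d))
    (hC₁ : σ₁ ∈ C₁.carrier) (hodd : Equiv.Perm.sign σ₁ = -1)
    (hfix : ∃ a b : Fin d, a ≠ b ∧ σ₁ a = a ∧ σ₁ b = b) :
    ∃ T : ℕ, ∀ (E : Equipment (Equiv.Perm (Fin d))) (i₁ : Fin E.m), E.C i₁ = C₁ →
      ∀ (σ : Equiv.Perm (Fin d)) (t : Fin E.m → ℕ), T ≤ t i₁ →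
        (∀ (H : AdmissibleCollection) (p : ℕ), (E.genSolutions H σ p t).Subsingleton) ∧
        (∀ (H H' : AdmissibleCollection) (p p' : ℕ),
          (E.genSolutions H σ p t).Nonempty ↔ (E.genSolutions H' σ p' t).Nonempty) ∧
        (∀ (H H' : AdmissibleCollection) (p p' : ℕ),
          (E.solutions H σ p t).Nonempty ↔ (E.solutions H' σ p' t).Nonempty) := by
  classical
  obtain ⟨a, b, hab, ha, hb⟩ := hfix
  set C : Finset (Equiv.Perm (Fin d)) := (Set.toFinite C₁.carrier).toFinset with hCdef
  have hC : ∀ g, g ∈ C ↔ g ∈ C₁.carrier := fun g => by simp [hCdef]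
  have hiff : ∀ g, g ∈ C ↔ IsConj σ₁ g := fun g => by
    rw [ConjClasses.mem_carrier_iff_mk_eq] at hC₁
    rw [hC, ConjClasses.mem_carrier_iff_mk_eq, ← hC₁, ConjClasses.mk_eq_mk_iff_isConj,
      isConj_comm]
  have hmem : σ₁ ∈ C := (hC σ₁).2 hC₁
  have hconj : ∀ g ∈ C, ∀ c, c * g * c⁻¹ ∈ C := fun g hg c =>
    (hiff _).2 (((hiff g).1 hg).trans (isConj_iff.2 ⟨c, rfl⟩))
  have hoddC : ∀ g ∈ C, Equiv.Perm.sign g = -1 := fun g hg => by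
    obtain ⟨c, rfl⟩ := isConj_iff.1 ((hiff g).1 hg)
    rw [map_mul, map_mul, hodd, mul_right_comm, ← map_mul, mul_inv_cancel, map_one, one_mul]
  -- The group order serves as exponent.
  have hG : BraidSystem.Good (C : Set (Equiv.Perm (Fin d))) C (Nat.card (Equiv.Perm (Fin d))) :=
    { conj_mem := hconj
      subset := fun g hg => hg
      isConj := fun g hg h hh => ((hiff g).1 hg).symm.trans ((hiff h).1 hh)
      nonempty := ⟨σ₁, hmem⟩
      pow_eq_one := fun g => pow_card_eq_one'
      ne_zero := Nat.card_pos.ne'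
      closure := closure_eq_top_of_odd (fun g hg c => hconj g hg c) hmem hodd ha }
  obtain ⟨T₁, hT₁⟩ := Equipment.exists_forall_genSolutions_subsingleton hG hC hmem hodd hab ha hb
  obtain ⟨T₂, hT₂⟩ := Equipment.exists_forall_genSolutions_nonempty hG hC hoddC
  refine ⟨max T₁ T₂, fun E i₁ hi σ t ht => ⟨?_, ?_, ?_⟩⟩
  · exact hT₁ E i₁ hi σ t ((le_max_left _ _).trans ht)
  · have key := hT₂ E i₁ hi σ t ((le_max_right _ _).trans ht)
    exact fun H H' p p' => ⟨fun ⟨z, hz⟩ => key H H' p p' ⟨z, hz.1⟩,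
      fun ⟨z, hz⟩ => key H' H p' p ⟨z, hz.1⟩⟩
  · have key := hT₂ E i₁ hi σ t ((le_max_right _ _).trans ht)
    have key' : ∀ (H H' : AdmissibleCollection) (p p' : ℕ), (E.solutions H σ p t).Nonempty →
        (E.solutions H' σ p' t).Nonempty := fun H H' p p' h => by
      obtain ⟨z, hz⟩ := key H H' p p' h
      exact ⟨z, hz.1⟩
    exact fun H H' p p' => ⟨key' H H' p p', key' H' H p' p⟩
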